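/- Let $\mathbb H$ be the quaternions, $\mathbb S^3\subset\mathbb H$ the unit sphere, and write tangent vectors of $\mathbb S^3\times\mathbb S^3$ at $(p,q)$ as $Z=(U,V)$ with $U\in T_p\mathbb S^3$, $V\in T_q\mathbb S^3$. Put $$JZ=\tfrac1{\sqrt3}\,(2pq^{-1}V-U,\,-2qp^{-1}U+V),\qquad PZ=(pq^{-1}V,\,qp^{-1}U),\qquad g(Z,Z')=\tfrac12\big(\langle Z,Z'\rangle+\langle JZ,JZ'\rangle\big),$$ where $\langle\cdot,\cdot\rangle$ is the standard product metric; this is the homogeneous nearly Kähler $\mathbb S^3\times\mathbb S^3$. Let $\tilde\nabla$ be the Levi-Civita connection of $g$ and $G=\tilde\nabla J$, i.e. $G(X,Y)=(\tilde\nabla_XJ)Y$. Let $M$ be a Lagrangian submanifold, i.e. an immersed smooth $3$-manifold such that $J$ maps the tangent spaces of $M$ onto its normal spaces. Let $\nabla$ and $\nabla^\perp$ be the induced connection and the normal connection, $h$ the second fundamental form, and $$(\nabla h)(X,Y,Z)=\nabla^\perp_Xh(Y,Z)-h(\nabla_XY,Z)-h(Y,\nabla_XZ).$$ For a function $\lambda:M\to\mathbb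 R$, say that $M$ is $J$-isotropic with function $\lambda$ if $$g((\nabla h)(v,v,v),Jv)=\lambda(x)\,(g(v,v))^2\qquad\text{for all }x\in M,\ v\in T_xM,$$ and $J$-isotropic if this holds for some function $\lambda$. **Proposition.** For every function $\lambda$ on $M$, $M$ is $J$-isotropic with function $\lambda$ if and only if $$\begin{aligned} &12\,g((\nabla h)(Y,Z,W),JV)+3\mathop{\mathfrak S}_{YZW}g(h(Y,Z),G(W,V))\\ &\quad+2\mathop{\mathfrak S}_{ZWV}\big[g(PY,Z)\,g(PJW,V)-g(PJY,Z)\,g(PW,V)\big] -4\lambda\mathop{\mathfrak S}_{ZWV}g(Y,Z)\,g(W,V)=0 \end{aligned}$$ for all smooth vector fields $Y,Z,W,V$ tangent to $M$, where $\mathfrak S$ denotes the cyclic sum over the three indicated arguments. In particular, $M$ is $J$-isotropic if and only if there is a function $\lambda$ on $M$ for which this identity holds for all $Y,Z,W,V$. -/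

import Mathlib

open scoped Quaternion Manifold ContDiff

noncomputable section

namespace NKS3S3

/-! ### The ambient space: pairs of quaternions, and `S³ × S³` inside it -/

/-- Pairs of quaternions. -/
abbrev HH : Type := ℍ × ℍ

instance fact_finrank_quaternion : Fact (Module.finrank ℝ ℍ = 3 + 1) :=
  ⟨Quaternion.finrank_eq_four⟩

/-- The unit sphere `S³` of the quaternions, with Mathlib's smooth structure. -/
abbrev S3 : Type := Metric.sphere (0 : ℍ) 1

/-- The subset `S³ × S³` of `ℍ × ℍ`. -/
def S3xS3 : Set HH := {x | ‖x.1‖ = 1 ∧ ‖x.2‖ = 1}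

/-- `Z = (U, V)` is tangent to `S³ × S³` at `x = (p, q)`, under the identification
`T_{(p,q)}(S³ × S³) = T_p S³ ⊕ T_q S³ = p^⊥ ⊕ q^⊥`. -/
def IsTangent (x Z : HH) : Prop := inner ℝ x.1 Z.1 = 0 ∧ inner ℝ x.2 Z.2 = 0

/-- The almost complex structure
`J (U, V) = (1/√3) (2 p q⁻¹ V - U, -2 q p⁻¹ U + V)` at `x = (p, q)`. -/
def nkJ (x Z : HH) : HH :=
  ((1 / Real.sqrt 3) • ((2 : ℝ) • (x.1 * x.2⁻¹ * Z.2) - Z.1),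
    (1 / Real.sqrt 3) • (-((2 : ℝ) • (x.2 * x.1⁻¹ * Z.1)) + Z.2))

/-- The almost product structure `P (U, V) = (p q⁻¹ V, q p⁻¹ U)` at `x = (p, q)`. -/
def nkP (x Z : HH) : HH := (x.1 * x.2⁻¹ * Z.2, x.2 * x.1⁻¹ * Z.1)

/-- The standard product metric. -/
def stdMetric (Z Z' : HH) : ℝ := inner ℝ Z.1 Z'.1 + inner ℝ Z.2 Z'.2

/-- The nearly Kähler metric `g(Z, Z') = (⟨Z, Z'⟩ + ⟨J Z, J Z'⟩) / 2` at `x`. -/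
def nkMetric (x Z Z' : HH) : ℝ :=
  1 / 2 * (stdMetric Z Z' + stdMetric (nkJ x Z) (nkJ x Z'))

/-! ### Vector fields on `S³ × S³` and the Levi-Civita connection of `g` -/

/-- A smooth vector field on `S³ × S³`, given by a map on `ℍ × ℍ` which is smooth at the points of
`S³ × S³` (only its values on `S³ × S³` matter) and tangent to `S³ × S³` there. -/
structure IsVectorField (X : HH → HH) : Prop where
  smooth : ∀ x ∈ S3xS3, ContDiffAt ℝ ∞ X x
  tangent : ∀ x ∈ S3xS3, IsTangent x (X x)

/-- `D X Y = ∇̃_X Y` is the Levi-Civita connection of `g`: an affine connection on `S³ × S³` which is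
torsion-free and compatible with `g`. For fields `X`, `Y` tangent to `S³ × S³` the derivative
`X φ` is `fderiv ℝ φ x (X x)` and the Lie bracket `[X, Y]` is
`fderiv ℝ Y x (X x) - fderiv ℝ X x (Y x)`. -/
structure IsLeviCivita (D : (HH → HH) → (HH → HH) → HH → HH) : Prop where
  tangent : ∀ X Y, IsVectorField X → IsVectorField Y → ∀ x ∈ S3xS3, IsTangent x (D X Y x)
  add_left : ∀ X X' Y, IsVectorField X → IsVectorField X' → IsVectorField Y → ∀ x ∈ S3xS3,
    D (fun y => X y + X' y) Y x = D X Y x + D X' Y x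
  smul_left : ∀ (φ : HH → ℝ) (X Y : HH → HH), (∀ x ∈ S3xS3, ContDiffAt ℝ ∞ φ x) →
    IsVectorField X → IsVectorField Y → ∀ x ∈ S3xS3,
    D (fun y => φ y • X y) Y x = φ x • D X Y x
  add_right : ∀ X Y Y', IsVectorField X → IsVectorField Y → IsVectorField Y' → ∀ x ∈ S3xS3,
    D X (fun y => Y y + Y' y) x = D X Y x + D X Y' x
  leibniz : ∀ (φ : HH → ℝ) (X Y : HH → HH), (∀ x ∈ S3xS3, ContDiffAt ℝ ∞ φ x) →
    IsVectorField X → IsVectorField Y → ∀ x ∈ S3xS3,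
    D X (fun y => φ y • Y y) x = fderiv ℝ φ x (X x) • Y x + φ x • D X Y x
  torsion_free : ∀ X Y, IsVectorField X → IsVectorField Y → ∀ x ∈ S3xS3,
    D X Y x - D Y X x = fderiv ℝ Y x (X x) - fderiv ℝ X x (Y x)
  metric : ∀ X Y Z, IsVectorField X → IsVectorField Y → IsVectorField Z → ∀ x ∈ S3xS3,
    fderiv ℝ (fun y => nkMetric y (Y y) (Z y)) x (X x) =
      nkMetric x (D X Y x) (Z x) + nkMetric x (Y x) (D X Z x)

/-! ### Left translation and existence and uniqueness of the Levi-Civita connection -/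

/-- `(p, q), (a, b) ↦ (p a, q b)`. -/
def leftMul (x a : HH) : HH := (x.1 * a.1, x.2 * a.2)

/-- The left trivialization `(p, q), (U, V) ↦ (p⁻¹ U, q⁻¹ V)`, inverse to `leftMul`. -/
def leftTriv (x U : HH) : HH := (x.1⁻¹ * U.1, x.2⁻¹ * U.2)

/-- The left-invariant vector field `(p, q) ↦ (p a, q b)`. -/
def leftInv (a : HH) : HH → HH := fun x => leftMul x a

/-- Cross product of (imaginary) quaternions. -/
def cross (a b : ℍ) : ℍ := (1 / 2 : ℝ) • (a * b - b * a)

/-- The connection coefficients of the Levi-Civita connection in the left trivialization. -/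
def coeff (a b : HH) : HH :=
  (cross a.1 b.1 + (1 / 3 : ℝ) • (cross a.2 b.1 - cross a.1 b.2),
    cross a.2 b.2 + (1 / 3 : ℝ) • (cross a.1 b.2 - cross a.2 b.1))

/-- The Levi-Civita connection in the left trivialization. -/
def connFormula (X Y : HH → HH) (x : HH) : HH :=
  leftMul x (fderiv ℝ (fun y => leftTriv y (Y y)) x (X x)
    + coeff (leftTriv x (X x)) (leftTriv x (Y x)))

lemma ne_zero_of_mem {x : HH} (hx : x ∈ S3xS3) : x.1 ≠ 0 ∧ x.2 ≠ 0 := by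
  constructor
  · intro h; have := hx.1; simp [h] at this
  · intro h; have := hx.2; simp [h] at this

lemma leftMul_leftTriv {x : HH} (hx : x ∈ S3xS3) (U : HH) : leftMul x (leftTriv x U) = U := by
  obtain ⟨h1, h2⟩ := ne_zero_of_mem hx
  ext1 <;> simp [leftMul, leftTriv, h1, h2]

lemma leftTriv_leftMul {x : HH} (hx : x ∈ S3xS3) (a : HH) : leftTriv x (leftMul x a) = a := by
  obtain ⟨h1, h2⟩ := ne_zero_of_mem hx
  ext1 <;> simp [leftMul, leftTriv, h1, h2]

lemma inner_mul_left_of_norm {p : ℍ} (hp : ‖p‖ = 1) (a b : ℍ) :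
    inner ℝ (p * a) (p * b) = inner ℝ a b := by
  have h : Quaternion.normSq p = 1 := by rw [Quaternion.normSq_eq_norm_mul_self, hp]; norm_num
  rw [Quaternion.normSq_def'] at h
  have : inner ℝ (p * a) (p * b)
      = (p.re ^ 2 + p.imI ^ 2 + p.imJ ^ 2 + p.imK ^ 2) * inner ℝ a b := by
    simp only [Quaternion.inner_def, Quaternion.re_mul, Quaternion.imI_mul, Quaternion.imJ_mul,
      Quaternion.imK_mul, Quaternion.re_star, Quaternion.imI_star, Quaternion.imJ_star,
      Quaternion.imK_star]
    ring
  rw [this, h, one_mul]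

/-- `g` in the left trivialization. -/
def metric0 (a b : HH) : ℝ :=
  4 / 3 * (inner ℝ a.1 b.1 + inner ℝ a.2 b.2) - 2 / 3 * (inner ℝ a.1 b.2 + inner ℝ a.2 b.1)

lemma nkJ_leftMul {x : HH} (hx : x ∈ S3xS3) (a : HH) :
    nkJ x (leftMul x a) = leftMul x ((1 / Real.sqrt 3) • ((2 : ℝ) • a.2 - a.1),
      (1 / Real.sqrt 3) • (-((2 : ℝ) • a.1) + a.2)) := by
  obtain ⟨h1, h2⟩ := ne_zero_of_mem hx
  ext1 <;> simp [nkJ, leftMul, mul_assoc, h1, h2, mul_add, mul_sub]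

lemma nkMetric_leftMul {x : HH} (hx : x ∈ S3xS3) (a b : HH) :
    nkMetric x (leftMul x a) (leftMul x b) = metric0 a b := by
  simp only [nkMetric, stdMetric, nkJ_leftMul hx]
  simp only [leftMul, inner_mul_left_of_norm hx.1, inner_mul_left_of_norm hx.2, metric0,
    inner_smul_left, inner_smul_right, inner_add_left, inner_add_right, inner_sub_left,
    inner_sub_right, inner_neg_left, inner_neg_right]
  simp only [RCLike.conj_to_real]
  ring_nf
  have h4 : (Real.sqrt 3)⁻¹ ^ 2 = 1 / 3 := by
    rw [inv_pow, Real.sq_sqrt (by norm_num)]; norm_num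
  simp only [h4]
  ring

lemma nkMetric_eq {x : HH} (hx : x ∈ S3xS3) (U V : HH) :
    nkMetric x U V = metric0 (leftTriv x U) (leftTriv x V) := by
  rw [← nkMetric_leftMul hx, leftMul_leftTriv hx, leftMul_leftTriv hx]

lemma metric0_coeff (a b c : HH) :
    metric0 (coeff a b) c + metric0 b (coeff a c) = 0 := by
  simp only [metric0, coeff, cross, Quaternion.inner_def, Quaternion.re_mul, Quaternion.imI_mul,
    Quaternion.imJ_mul, Quaternion.imK_mul, Quaternion.re_star, Quaternion.imI_star,
    Quaternion.imJ_star, Quaternion.imK_star, Quaternion.re_add, Quaternion.imI_add,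
    Quaternion.imJ_add, Quaternion.imK_add, Quaternion.re_sub, Quaternion.imI_sub,
    Quaternion.imJ_sub, Quaternion.imK_sub, Quaternion.re_smul, Quaternion.imI_smul,
    Quaternion.imJ_smul, Quaternion.imK_smul, smul_eq_mul]
  ring

lemma coeff_sub (a b : HH) : coeff a b - coeff b a = a * b - b * a := by
  ext1 <;> simp only [coeff, cross, Prod.fst_sub, Prod.snd_sub, Prod.fst_mul, Prod.snd_mul] <;>
    module

lemma coeff_re (a b : HH) : (coeff a b).1.re = 0 ∧ (coeff a b).2.re = 0 := by
  simp only [coeff, cross, Quaternion.re_add, Quaternion.re_sub, Quaternion.re_smul,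
    Quaternion.re_mul, smul_eq_mul]
  constructor <;> ring

lemma metric0_self_pos {a : HH} (h : metric0 a a = 0) : a = 0 := by
  have e : metric0 a a = 1 / 3 * (inner ℝ (a.1 - a.2) (a.1 - a.2)) * 2
      + 2 / 3 * (inner ℝ a.1 a.1 + inner ℝ a.2 a.2) := by
    simp only [metric0, inner_sub_left, inner_sub_right, real_inner_comm]; ring
  rw [h] at e
  simp only [real_inner_self_eq_norm_sq] at e
  have h1 : ‖a.1‖ ^ 2 = 0 := by nlinarith [sq_nonneg ‖a.1 - a.2‖, sq_nonneg ‖a.1‖, sq_nonneg ‖a.2‖]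
  have h2 : ‖a.2‖ ^ 2 = 0 := by nlinarith [sq_nonneg ‖a.1 - a.2‖, sq_nonneg ‖a.1‖, sq_nonneg ‖a.2‖]
  ext1
  · simpa using h1
  · simpa using h2

lemma isTangent_leftMul_iff {x : HH} (hx : x ∈ S3xS3) (a : HH) :
    IsTangent x (leftMul x a) ↔ a.1.re = 0 ∧ a.2.re = 0 := by
  have k : ∀ {p : ℍ}, ‖p‖ = 1 → ∀ b : ℍ, inner ℝ p (p * b) = b.re := by
    intro p hp b
    have := inner_mul_left_of_norm hp 1 b
    rw [mul_one] at this
    rw [this]; simp [Quaternion.inner_def]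
  simp only [IsTangent, leftMul, k hx.1, k hx.2]

lemma re_leftTriv {x : HH} (hx : x ∈ S3xS3) {U : HH} (hU : IsTangent x U) :
    (leftTriv x U).1.re = 0 ∧ (leftTriv x U).2.re = 0 := by
  rwa [← isTangent_leftMul_iff hx, leftMul_leftTriv hx]

lemma leftInv_isVectorField {a : HH} (h1 : a.1.re = 0) (h2 : a.2.re = 0) :
    IsVectorField (leftInv a) where
  smooth x _ := by
    unfold leftInv leftMul
    exact ((contDiff_fst.mul contDiff_const).prodMk (contDiff_snd.mul contDiff_const)).contDiffAt
  tangent x hx := (isTangent_leftMul_iff hx a).2 ⟨h1, h2⟩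

lemma contDiffAt_leftTriv {x : HH} (hx : x ∈ S3xS3) {Y : HH → HH} (hY : ContDiffAt ℝ ∞ Y x) :
    ContDiffAt ℝ ∞ (fun y => leftTriv y (Y y)) x := by
  obtain ⟨h1, h2⟩ := ne_zero_of_mem hx
  unfold leftTriv
  have k : ∀ {p : ℍ}, p ≠ 0 → ContDiffAt ℝ ∞ (fun z : ℍ => z⁻¹) p := by
    intro p hp
    have := contDiffAt_ringInverse ℝ (n := ∞) (Units.mk0 p hp)
    rwa [Ring.inverse_eq_inv'] at this
  have e1 : ContDiffAt ℝ ∞ (fun y : HH => y.1⁻¹) x :=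
    ContDiffAt.comp (f := Prod.fst) (g := fun z : ℍ => z⁻¹) x (k h1) contDiffAt_fst
  have e2 : ContDiffAt ℝ ∞ (fun y : HH => y.2⁻¹) x :=
    ContDiffAt.comp (f := Prod.snd) (g := fun z : ℍ => z⁻¹) x (k h2) contDiffAt_snd
  exact (e1.mul hY.fst).prodMk (e2.mul hY.snd)

/-- The derivative along `S³ × S³` only sees the values on `S³ × S³`. -/
lemma fderiv_congr {F : Type*} [NormedAddCommGroup F] [NormedSpace ℝ F] {φ ψ : HH → F} {x u : HH}
    (hx : x ∈ S3xS3) (hu : IsTangent x u) (hφ : DifferentiableAt ℝ φ x)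
    (hψ : DifferentiableAt ℝ ψ x) (h : ∀ y ∈ S3xS3, φ y = ψ y) :
    fderiv ℝ φ x u = fderiv ℝ ψ x u := by
  have key : ∀ p U : ℍ, ‖p‖ = 1 → inner ℝ p U = 0 → ∃ c : ℝ → ℍ, c 0 = p ∧ HasDerivAt c U 0 ∧
      ∀ t, ‖c t‖ = 1 := by
    intro p U hp hU
    have hn : ∀ t : ℝ, ‖p + t • U‖ ^ 2 = 1 + t ^ 2 * ‖U‖ ^ 2 := by
      intro t
      rw [norm_add_sq_real, inner_smul_right, hU, hp, norm_smul, mul_pow]; simp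
    have hn' : ∀ t : ℝ, ‖p + t • U‖ = Real.sqrt (1 + t ^ 2 * ‖U‖ ^ 2) := by
      intro t; rw [← hn, Real.sqrt_sq (norm_nonneg _)]
    have hpos : ∀ t : ℝ, 0 < 1 + t ^ 2 * ‖U‖ ^ 2 := fun t => by positivity
    refine ⟨fun t => (Real.sqrt (1 + t ^ 2 * ‖U‖ ^ 2))⁻¹ • (p + t • U), by simp, ?_, ?_⟩
    · have d1 : HasDerivAt (fun t : ℝ => 1 + t ^ 2 * ‖U‖ ^ 2) 0 0 := by
        have := ((hasDerivAt_pow 2 (0 : ℝ)).mul_const (‖U‖ ^ 2)).const_add 1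
        simpa using this
      have d2 := (d1.sqrt (hpos 0).ne').inv (by
        rw [Real.sqrt_ne_zero']; exact hpos 0)
      have d3 : HasDerivAt (fun t : ℝ => p + t • U) U 0 := by
        have := ((hasDerivAt_id (0 : ℝ)).smul_const U).const_add p
        simpa using this
      have d4 := d2.smul d3
      have d5 : (fun t : ℝ => (Real.sqrt (1 + t ^ 2 * ‖U‖ ^ 2))⁻¹ • (p + t • U))
          = (fun t : ℝ => Real.sqrt (1 + t ^ 2 * ‖U‖ ^ 2))⁻¹ • fun t : ℝ => p + t • U := rfl
      rw [d5]
      simpa using d4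
    · intro t
      rw [norm_smul, hn', norm_inv, Real.norm_eq_abs, abs_of_nonneg (Real.sqrt_nonneg _)]
      exact inv_mul_cancel₀ (by rw [Real.sqrt_ne_zero']; exact hpos t)
  obtain ⟨c, c0, cd, cn⟩ := key x.1 u.1 hx.1 hu.1
  obtain ⟨d, d0, dd, dn⟩ := key x.2 u.2 hx.2 hu.2
  have hcd : HasDerivAt (fun t => (c t, d t)) u 0 := cd.prodMk dd
  have h0 : (c 0, d 0) = x := by rw [c0, d0]
  have e1 : HasDerivAt (fun t => φ (c t, d t)) (fderiv ℝ φ x u) 0 := by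
    have : HasFDerivAt φ (fderiv ℝ φ x) (c 0, d 0) := by rw [h0]; exact hφ.hasFDerivAt
    exact this.comp_hasDerivAt 0 hcd
  have e2 : HasDerivAt (fun t => ψ (c t, d t)) (fderiv ℝ ψ x u) 0 := by
    have : HasFDerivAt ψ (fderiv ℝ ψ x) (c 0, d 0) := by rw [h0]; exact hψ.hasFDerivAt
    exact this.comp_hasDerivAt 0 hcd
  have e3 : (fun t => φ (c t, d t)) = fun t => ψ (c t, d t) := by
    funext t; exact h _ ⟨cn t, dn t⟩
  rw [e3] at e1
  exact e1.unique e2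

lemma coeff_add_left (a a' b : HH) : coeff (a + a') b = coeff a b + coeff a' b := by
  ext1 <;> simp only [coeff, cross, Prod.fst_add, Prod.snd_add, add_mul, mul_add] <;> module

lemma coeff_add_right (a b b' : HH) : coeff a (b + b') = coeff a b + coeff a b' := by
  ext1 <;> simp only [coeff, cross, Prod.fst_add, Prod.snd_add, add_mul, mul_add] <;> module

lemma coeff_smul_left (r : ℝ) (a b : HH) : coeff (r • a) b = r • coeff a b := by
  ext1 <;> simp only [coeff, cross, Prod.smul_fst, Prod.smul_snd, smul_mul_assoc, mul_smul_comm] <;>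
    module

lemma coeff_smul_right (r : ℝ) (a b : HH) : coeff a (r • b) = r • coeff a b := by
  ext1 <;> simp only [coeff, cross, Prod.smul_fst, Prod.smul_snd, smul_mul_assoc, mul_smul_comm] <;>
    module

lemma leftTriv_add (x U V : HH) : leftTriv x (U + V) = leftTriv x U + leftTriv x V := by
  ext1 <;> simp [leftTriv, mul_add]

lemma leftTriv_smul (x : HH) (r : ℝ) (U : HH) : leftTriv x (r • U) = r • leftTriv x U := by
  ext1 <;> simp [leftTriv]

lemma leftMul_add (x a b : HH) : leftMul x (a + b) = leftMul x a + leftMul x b := by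
  ext1 <;> simp [leftMul, mul_add]

lemma leftMul_smul (x : HH) (r : ℝ) (a : HH) : leftMul x (r • a) = r • leftMul x a := by
  ext1 <;> simp [leftMul]

lemma IsVectorField.differentiableAt_leftTriv {Y : HH → HH} (hY : IsVectorField Y) {x : HH}
    (hx : x ∈ S3xS3) : DifferentiableAt ℝ (fun y => leftTriv y (Y y)) x :=
  (contDiffAt_leftTriv hx (hY.smooth x hx)).differentiableAt (by simp)

lemma fderiv_eq_leftMul {Y : HH → HH} (hY : IsVectorField Y) {x u : HH} (hx : x ∈ S3xS3)
    (hu : IsTangent x u) :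
    fderiv ℝ Y x u = leftMul x (leftTriv x u * leftTriv x (Y x)
      + fderiv ℝ (fun y => leftTriv y (Y y)) x u) := by
  have hd := hY.differentiableAt_leftTriv hx
  set y := fun y => leftTriv y (Y y) with hy
  have e : fderiv ℝ Y x u = fderiv ℝ (fun z => z * y z) x u := by
    refine fderiv_congr hx hu ((hY.smooth x hx).differentiableAt (by simp)) (by fun_prop) ?_
    intro z hz
    exact (leftMul_leftTriv hz (Y z)).symm
  have e2 : HasFDerivAt (fun z => z * y z) _ x := (hasFDerivAt_id (𝕜 := ℝ) x).mul' hd.hasFDerivAt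
  rw [e, e2.fderiv]
  have hu' : u = x * leftTriv x u := (leftMul_leftTriv hx u).symm
  change x * fderiv ℝ y x u + u * y x = x * (leftTriv x u * leftTriv x (Y x) + fderiv ℝ y x u)
  rw [mul_add, ← mul_assoc, ← hu', add_comm]

lemma fderiv_metric0 {a b : HH → HH} {x : HH} (ha : DifferentiableAt ℝ a x)
    (hb : DifferentiableAt ℝ b x) (u : HH) :
    DifferentiableAt ℝ (fun y => metric0 (a y) (b y)) x ∧
    fderiv ℝ (fun y => metric0 (a y) (b y)) x u
      = metric0 (fderiv ℝ a x u) (b x) + metric0 (a x) (fderiv ℝ b x u) := by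
  have a1 := ha.hasFDerivAt.fst
  have a2 := ha.hasFDerivAt.snd
  have b1 := hb.hasFDerivAt.fst
  have b2 := hb.hasFDerivAt.snd
  have h := ((((a1.inner ℝ b1).add (a2.inner ℝ b2)).const_mul (4 / 3)).sub
    (((a1.inner ℝ b2).add (a2.inner ℝ b1)).const_mul (2 / 3)))
  have h' : HasFDerivAt (fun y => metric0 (a y) (b y)) _ x := h
  refine ⟨h'.differentiableAt, ?_⟩
  rw [h'.fderiv]
  simp [metric0]
  ring

lemma metric0_add_left (a a' b : HH) : metric0 (a + a') b = metric0 a b + metric0 a' b := by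
  simp only [metric0, Prod.fst_add, Prod.snd_add, inner_add_left]; ring

lemma metric0_add_right (a b b' : HH) : metric0 a (b + b') = metric0 a b + metric0 a b' := by
  simp only [metric0, Prod.fst_add, Prod.snd_add, inner_add_right]; ring

lemma metric0_comm (a b : HH) : metric0 a b = metric0 b a := by
  simp only [metric0, real_inner_comm]; ring

lemma IsVectorField.add {X Y : HH → HH} (hX : IsVectorField X) (hY : IsVectorField Y) :
    IsVectorField (fun y => X y + Y y) where
  smooth x hx := (hX.smooth x hx).add (hY.smooth x hx)
  tangent x hx := by
    have h1 := hX.tangent x hx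
    have h2 := hY.tangent x hx
    simp [IsTangent, inner_add_right, h1.1, h1.2, h2.1, h2.2]

lemma differentiableAt_nkMetric {Y Z : HH → HH} (hY : IsVectorField Y) (hZ : IsVectorField Z)
    {x : HH} (hx : x ∈ S3xS3) : DifferentiableAt ℝ (fun y => nkMetric y (Y y) (Z y)) x := by
  have key : ∀ {Y : HH → HH}, IsVectorField Y →
      DifferentiableAt ℝ (fun y => nkJ y (Y y)) x := by
    intro Y hY
    have h1 := (hY.smooth x hx).differentiableAt (n := ∞) (by simp)
    have h2 := hY.differentiableAt_leftTriv hx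
    have h3 : DifferentiableAt ℝ (fun y => (leftTriv y (Y y)).1) x := h2.fst
    have h4 : DifferentiableAt ℝ (fun y => (leftTriv y (Y y)).2) x := h2.snd
    have e : (fun y => nkJ y (Y y)) = fun y =>
        ((1 / Real.sqrt 3) • ((2 : ℝ) • (y.1 * (leftTriv y (Y y)).2) - (Y y).1),
          (1 / Real.sqrt 3) • (-((2 : ℝ) • (y.2 * (leftTriv y (Y y)).1)) + (Y y).2)) := by
      funext y; simp only [nkJ, leftTriv, mul_assoc]
    rw [e]
    fun_prop
  have hY1 := (hY.smooth x hx).differentiableAt (n := ∞) (by simp)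
  have hZ1 := (hZ.smooth x hx).differentiableAt (n := ∞) (by simp)
  have k1 := key hY
  have k2 := key hZ
  have i1 := hY1.fst.inner ℝ hZ1.fst
  have i2 := hY1.snd.inner ℝ hZ1.snd
  have i3 := k1.fst.inner ℝ k2.fst
  have i4 := k1.snd.inner ℝ k2.snd
  exact ((i1.add i2).add (i3.add i4)).const_mul (1 / 2)

theorem connFormula_isLeviCivita : IsLeviCivita connFormula where
  tangent X Y hX hY x hx := by
    have hd := hY.differentiableAt_leftTriv hx
    have r1 : ∀ (L : HH →L[ℝ] ℝ), (∀ y ∈ S3xS3, L (leftTriv y (Y y)) = 0) →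
        L (fderiv ℝ (fun y => leftTriv y (Y y)) x (X x)) = 0 := by
      intro L hL
      have h1 := (L.hasFDerivAt.comp x hd.hasFDerivAt)
      have h2 := fderiv_congr (φ := fun y => L (leftTriv y (Y y))) (ψ := fun _ => 0) hx
        (hX.tangent x hx) h1.differentiableAt (differentiableAt_const _) hL
      have h3 : fderiv ℝ (fun y => L (leftTriv y (Y y))) x = _ := h1.fderiv
      rw [h3] at h2
      simpa using h2
    have c := coeff_re (leftTriv x (X x)) (leftTriv x (Y x))
    refine (isTangent_leftMul_iff hx _).2 ⟨?_, ?_⟩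
    · have := r1 ((innerSL ℝ (1 : ℍ)).comp (ContinuousLinearMap.fst ℝ ℍ ℍ)) (fun y hy => by
        simpa [Quaternion.inner_def] using (re_leftTriv hy (hY.tangent y hy)).1)
      simpa [Quaternion.inner_def, c.1] using this
    · have := r1 ((innerSL ℝ (1 : ℍ)).comp (ContinuousLinearMap.snd ℝ ℍ ℍ)) (fun y hy => by
        simpa [Quaternion.inner_def] using (re_leftTriv hy (hY.tangent y hy)).2)
      simpa [Quaternion.inner_def, c.2] using this
  add_left X X' Y _ _ _ x _ := by
    simp only [connFormula, map_add, leftTriv_add, coeff_add_left, ← leftMul_add]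
    congr 1; abel
  smul_left φ X Y _ _ _ x _ := by
    simp only [connFormula, map_smul, leftTriv_smul, coeff_smul_left, ← leftMul_smul, smul_add]
  add_right X Y Y' _ hY hY' x hx := by
    have h := (hY.differentiableAt_leftTriv hx).hasFDerivAt.add
      (hY'.differentiableAt_leftTriv hx).hasFDerivAt
    have e0 : (fun y => leftTriv y (Y y + Y' y))
        = (fun y => leftTriv y (Y y)) + fun y => leftTriv y (Y' y) := by
      funext y; exact leftTriv_add _ _ _
    have e := h.fderiv
    rw [← e0] at e
    simp only [connFormula]
    rw [e]
    simp only [leftTriv_add, coeff_add_right, ← leftMul_add]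
    congr 1
    rw [add_apply]
    abel
  leibniz φ X Y hφ _ hY x hx := by
    have h := ((hφ x hx).differentiableAt (by simp)).hasFDerivAt.smul
      (hY.differentiableAt_leftTriv hx).hasFDerivAt
    have e0 : (fun y => leftTriv y (φ y • Y y)) = φ • fun y => leftTriv y (Y y) := by
      funext y; exact leftTriv_smul _ _ _
    have e := h.fderiv
    rw [← e0] at e
    simp only [connFormula]
    rw [e]
    simp only [leftTriv_smul, coeff_smul_right]
    rw [← leftMul_smul, ← leftMul_leftTriv hx (fderiv ℝ φ x (X x) • Y x), ← leftMul_add]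
    congr 1
    simp [leftTriv_smul]
    abel
  torsion_free X Y hX hY x hx := by
    rw [fderiv_eq_leftMul hY hx (hX.tangent x hx), fderiv_eq_leftMul hX hx (hY.tangent x hx)]
    have c := coeff_sub (leftTriv x (X x)) (leftTriv x (Y x))
    have m : ∀ a b : HH, leftMul x a - leftMul x b = leftMul x (a - b) := by
      intro a b; ext1 <;> simp [leftMul, mul_sub]
    simp only [connFormula, m]
    congr 1
    rw [add_sub_add_comm, c]
    abel
  metric X Y Z hX hY hZ x hx := by
    have dY := hY.differentiableAt_leftTriv hx
    have dZ := hZ.differentiableAt_leftTriv hx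
    obtain ⟨h1, h2⟩ := fderiv_metric0 dY dZ (X x)
    rw [fderiv_congr hx (hX.tangent x hx) (differentiableAt_nkMetric hY hZ hx) h1
      (fun y hy => nkMetric_eq hy _ _), h2]
    simp only [nkMetric_eq hx, connFormula, leftTriv_leftMul hx, metric0_add_left,
      metric0_add_right]
    have := metric0_coeff (leftTriv x (X x)) (leftTriv x (Y x)) (leftTriv x (Z x))
    linarith

/-- Existence half of the fundamental theorem of Riemannian geometry, for `g`. -/
theorem exists_isLeviCivita : ∃ D, IsLeviCivita D := ⟨connFormula, connFormula_isLeviCivita⟩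

/-- Uniqueness half: on vector fields, any two Levi-Civita connections agree along `S³ × S³`. -/
theorem IsLeviCivita.unique {D D' : (HH → HH) → (HH → HH) → HH → HH} (hD : IsLeviCivita D)
    (hD' : IsLeviCivita D') {X Y : HH → HH} (hX : IsVectorField X) (hY : IsVectorField Y) {x : HH}
    (hx : x ∈ S3xS3) : D X Y x = D' X Y x := by
  -- the difference tensor `E` is symmetric in its two arguments and skew with respect to `g`
  have symm : ∀ X Y, IsVectorField X → IsVectorField Y →
      D X Y x - D' X Y x = D Y X x - D' Y X x := by
    intro X Y hX hY
    have h1 := hD.torsion_free X Y hX hY x hx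
    have h2 := hD'.torsion_free X Y hX hY x hx
    rw [← h2] at h1
    rw [sub_eq_sub_iff_add_eq_add] at h1 ⊢
    rw [h1]; abel
  have skew : ∀ X Y Z, IsVectorField X → IsVectorField Y → IsVectorField Z →
      metric0 (leftTriv x (D X Y x - D' X Y x)) (leftTriv x (Z x))
        = - metric0 (leftTriv x (D X Z x - D' X Z x)) (leftTriv x (Y x)) := by
    intro X Y Z hX hY hZ
    have h1 := hD.metric X Y Z hX hY hZ x hx
    have h2 := hD'.metric X Y Z hX hY hZ x hx
    rw [h1] at h2
    simp only [nkMetric_eq hx] at h2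
    have s : ∀ U V, leftTriv x (U - V) = leftTriv x U + (-1 : ℝ) • leftTriv x V := by
      intro U V; rw [sub_eq_add_neg, ← neg_one_smul ℝ V, leftTriv_add, leftTriv_smul]
    have n : ∀ a b, metric0 ((-1 : ℝ) • a) b = - metric0 a b := by
      intro a b; simp [metric0]; ring
    simp only [s, metric0_add_left, n]
    rw [metric0_comm (leftTriv x (Y x)) (leftTriv x (D X Z x)),
      metric0_comm (leftTriv x (Y x)) (leftTriv x (D' X Z x))] at h2
    linarith
  have zero : ∀ Z, IsVectorField Z →
      metric0 (leftTriv x (D X Y x - D' X Y x)) (leftTriv x (Z x)) = 0 := by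
    intro Z hZ
    have h1 := skew X Y Z hX hY hZ
    have h2 := skew Z X Y hZ hX hY
    have h3 := skew Y Z X hY hZ hX
    rw [symm X Z hX hZ] at h1
    rw [symm Z Y hZ hY] at h2
    rw [symm Y X hY hX] at h3
    linarith
  obtain ⟨t1, t2⟩ := re_leftTriv hx (hD.tangent X Y hX hY x hx)
  obtain ⟨t3, t4⟩ := re_leftTriv hx (hD'.tangent X Y hX hY x hx)
  set a := leftTriv x (D X Y x - D' X Y x) with ha
  have ha1 : a = leftTriv x (D X Y x) - leftTriv x (D' X Y x) := by
    ext1 <;> simp [ha, leftTriv, mul_sub]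
  have hZ : IsVectorField (leftInv a) := by
    apply leftInv_isVectorField
    · rw [ha1]; simp [t1, t3]
    · rw [ha1]; simp [t2, t4]
  have h0 := zero _ hZ
  rw [show leftTriv x (leftInv a x) = a from leftTriv_leftMul hx a] at h0
  have h5 := metric0_self_pos h0
  have h6 : D X Y x - D' X Y x = 0 := by
    rw [← leftMul_leftTriv hx (D X Y x - D' X Y x), ← ha, h5]
    ext1 <;> simp [leftMul]
  exact sub_eq_zero.1 h6

/-- The Levi-Civita connection `∇̃` of `g`; `leviCivita X Y` is `∇̃_X Y`. -/
def leviCivita : (HH → HH) → (HH → HH) → HH → HH := Classical.choose exists_isLeviCivita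

theorem leviCivita_spec : IsLeviCivita leviCivita := Classical.choose_spec exists_isLeviCivita

theorem leviCivita_eq_connFormula {X Y : HH → HH} (hX : IsVectorField X) (hY : IsVectorField Y)
    {x : HH} (hx : x ∈ S3xS3) : leviCivita X Y x = connFormula X Y x :=
  leviCivita_spec.unique connFormula_isLeviCivita hX hY hx

/-- The tensor field `G = ∇̃ J`, i.e. `G(u, v) = (∇̃_u J) v = ∇̃_X (J Y) - J ∇̃_X Y` for vector fields
`X`, `Y` extending the tangent vectors `u`, `v` at `x`; the left-invariant extensions are used. -/
def nkG (x u v : HH) : HH :=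
  leviCivita (leftInv (leftTriv x u)) (fun y => nkJ y (leftInv (leftTriv x v) y)) x
    - nkJ x (leviCivita (leftInv (leftTriv x u)) (leftInv (leftTriv x v)) x)

/-! ### Lagrangian immersions -/

/-- A map into `S³ × S³`, regarded as a map into `ℍ × ℍ`. -/
def emb {M : Type*} (f : M → S3 × S3) (m : M) : HH := ((f m).1, (f m).2)

lemma emb_mem {M : Type*} (f : M → S3 × S3) (m : M) : emb f m ∈ S3xS3 :=
  ⟨mem_sphere_zero_iff_norm.1 (f m).1.2, mem_sphere_zero_iff_norm.1 (f m).2.2⟩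

variable {M : Type*} [TopologicalSpace M] [ChartedSpace (EuclideanSpace ℝ (Fin 3)) M]

/-- The differential `df_m : T_m M → T_{f m} (S³ × S³) ⊆ ℍ × ℍ`. -/
def dmap (f : M → S3 × S3) (m : M) (v : TangentSpace (𝓡 3) m) : HH :=
  mfderiv (𝓡 3) 𝓘(ℝ, HH) (emb f) m v

/-- A smooth immersion `f : M³ → S³ × S³` is Lagrangian: `J` maps the tangent spaces of `M`
onto its normal spaces. -/
structure IsLagrangianImmersion (f : M → S3 × S3) : Prop where
  smooth : ContMDiff (𝓡 3) ((𝓡 3).prod (𝓡 3)) ∞ f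
  immersion : ∀ m, Function.Injective (dmap f m)
  lagrangian : ∀ m, ∀ ξ : HH, (∃ u : TangentSpace (𝓡 3) m, ξ = nkJ (emb f m) (dmap f m u)) ↔
    (IsTangent (emb f m) ξ ∧ ∀ w : TangentSpace (𝓡 3) m, nkMetric (emb f m) ξ (dmap f m w) = 0)

/-- Smooth vector fields on `M`. -/
def IsSmoothField [IsManifold (𝓡 3) ∞ M] (X : ∀ m : M, TangentSpace (𝓡 3) m) : Prop :=
  ContMDiff (𝓡 3) (𝓡 3).tangent ∞ (fun m => (⟨m, X m⟩ : TangentBundle (𝓡 3) M))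

/-- Every tangent vector of `M` extends to a smooth vector field on `M`. -/
lemma exists_isSmoothField [IsManifold (𝓡 3) ∞ M] [T2Space M] (m : M) (v : TangentSpace (𝓡 3) m) :
    ∃ X : ∀ m : M, TangentSpace (𝓡 3) m, IsSmoothField X ∧ X m = v := by
  have : IsManifold (𝓡 3) (∞ + 1) M := ‹IsManifold (𝓡 3) ∞ M›
  obtain ⟨s, hs, hX⟩ := FiberBundle.exists_contMDiffOn_extend (k := ∞) (𝓡 3)
    (EuclideanSpace ℝ (Fin 3)) v
  obtain ⟨φ, -, hφ⟩ := (SmoothBumpFunction.nhds_basis_tsupport (I := 𝓡 3) m).mem_iff.1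
    (interior_mem_nhds.2 hs)
  refine ⟨(φ : M → ℝ) • FiberBundle.extend (EuclideanSpace ℝ (Fin 3)) v, ?_, ?_⟩
  · exact ContMDiffOn.smul_section_of_tsupport φ.contMDiff.contMDiffOn isOpen_interior hφ
      (hX.mono interior_subset)
  · simp

/-- The pull-back by `f` of the Levi-Civita connection: `∇̃_v V` for `v ∈ T_m M` and a vector field
`V` along `f`. In terms of a left-invariant frame `E_a` of `S³ × S³`, if `V = ∑ V^a E_a`
then `∇̃_v V = ∑ (v V^a) E_a + ∑ V^a ∇̃_{df v} E_a`. -/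
def pullConn (f : M → S3 × S3) (m : M) (v : TangentSpace (𝓡 3) m) (V : M → HH) : HH :=
  leftMul (emb f m) (mfderiv (𝓡 3) 𝓘(ℝ, HH) (fun m' => leftTriv (emb f m') (V m')) m v)
    + leviCivita (leftInv (leftTriv (emb f m) (dmap f m v)))
        (leftInv (leftTriv (emb f m) (V m))) (emb f m)

/-- `pullConn` is the pull-back connection: on the restriction to `M` of a vector field `Y` of
`S³ × S³` it is `∇̃_X Y`, where `X` extends `df v`. -/
theorem pullConn_comp (f : M → S3 × S3) (m : M) (v : TangentSpace (𝓡 3) m)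
    (hf : MDifferentiableAt (𝓡 3) 𝓘(ℝ, HH) (emb f) m) {X Y : HH → HH} (hX : IsVectorField X)
    (hY : IsVectorField Y) (hv : X (emb f m) = dmap f m v) :
    pullConn f m v (fun m' => Y (emb f m')) = leviCivita X Y (emb f m) := by
  have hx := emb_mem f m
  have r1 := re_leftTriv hx (hX.tangent _ hx)
  have r2 := re_leftTriv hx (hY.tangent _ hx)
  have e : ∀ w : TangentSpace (𝓡 3) m,
      mfderiv (𝓡 3) 𝓘(ℝ, HH) (fun m' => leftTriv (emb f m') (Y (emb f m'))) m w
        = fderiv ℝ (fun y => leftTriv y (Y y)) (emb f m) (dmap f m w) := by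
    intro w
    have := mfderiv_comp (I := 𝓡 3) (I' := 𝓘(ℝ, HH)) (I'' := 𝓘(ℝ, HH)) m
      (hY.differentiableAt_leftTriv hx).mdifferentiableAt hf
    rw [mfderiv_eq_fderiv] at this
    exact congrArg (fun L => L w) this
  have k : ∀ {a b : HH}, a.1.re = 0 ∧ a.2.re = 0 → b.1.re = 0 ∧ b.2.re = 0 →
      leviCivita (leftInv a) (leftInv b) (emb f m) = leftMul (emb f m) (coeff a b) := by
    intro a b ha hb
    have hb' := leftInv_isVectorField hb.1 hb.2
    rw [leviCivita_eq_connFormula (leftInv_isVectorField ha.1 ha.2) hb' hx]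
    have hz := fderiv_congr (φ := fun y => leftTriv y (leftInv b y)) (ψ := fun _ => b) hx
      ((leftInv_isVectorField ha.1 ha.2).tangent _ hx) (hb'.differentiableAt_leftTriv hx)
      (differentiableAt_const _) (fun y hy => leftTriv_leftMul hy b)
    simp only [connFormula]
    rw [hz]
    simp [leftInv, leftTriv_leftMul hx]
  unfold pullConn
  rw [← hv, k r1 r2, e v, ← hv, leviCivita_eq_connFormula hX hY hx, connFormula, leftMul_add]

open Classical in
/-- The tangential part of `ξ ∈ T_{f m} (S³ × S³)`, as an element of `T_m M`: the vector `u` such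
that `ξ - df u` is `g`-orthogonal to the tangent space of `M`. -/
def tanPart (f : M → S3 × S3) (m : M) (ξ : HH) : TangentSpace (𝓡 3) m :=
  if h : ∃ u : TangentSpace (𝓡 3) m, ∀ w : TangentSpace (𝓡 3) m,
      nkMetric (emb f m) (ξ - dmap f m u) (dmap f m w) = 0
  then Classical.choose h else 0

/-- The normal part of `ξ ∈ T_{f m} (S³ × S³)`. -/
def norPart (f : M → S3 × S3) (m : M) (ξ : HH) : HH := ξ - dmap f m (tanPart f m ξ)

/-- The induced connection `∇_X Y` on `M` (Gauss formula). -/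
def indConn (f : M → S3 × S3) (X Y : ∀ m : M, TangentSpace (𝓡 3) m) (m : M) :
    TangentSpace (𝓡 3) m :=
  tanPart f m (pullConn f m (X m) (fun m' => dmap f m' (Y m')))

/-- The second fundamental form `h(X, Y)` (Gauss formula). -/
def secondFF (f : M → S3 × S3) (X Y : ∀ m : M, TangentSpace (𝓡 3) m) (m : M) : HH :=
  norPart f m (pullConn f m (X m) (fun m' => dmap f m' (Y m')))

/-- The normal connection `∇^⊥_X ξ` (Weingarten formula). -/
def norConn (f : M → S3 × S3) (X : ∀ m : M, TangentSpace (𝓡 3) m) (ξ : M → HH) (m : M) : HH :=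
  norPart f m (pullConn f m (X m) ξ)

/-- `(∇h)(X, Y, Z) = ∇^⊥_X h(Y, Z) - h(∇_X Y, Z) - h(Y, ∇_X Z)`. -/
def nablaH (f : M → S3 × S3) (X Y Z : ∀ m : M, TangentSpace (𝓡 3) m) (m : M) : HH :=
  norConn f X (secondFF f Y Z) m - secondFF f (indConn f X Y) Z m - secondFF f Y (indConn f X Z) m

/-- The cyclic sum. -/
def cyclicSum {A : Type*} (F : A → A → A → ℝ) (a b c : A) : ℝ := F a b c + F b c a + F c a b

/-- `f` is `J`-isotropic with function `lam`: `g((∇h)(v, v, v), J v) = lam(m) g(v, v)²` for every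
tangent vector `v ∈ T_m M`. The tensor `∇h` is evaluated on `v` by means of vector fields `X` on `M`
with `X m = v`. -/
def IsJIsotropicWith [IsManifold (𝓡 3) ∞ M] (f : M → S3 × S3) (lam : M → ℝ) : Prop :=
  ∀ (m : M) (v : TangentSpace (𝓡 3) m) (X : ∀ m : M, TangentSpace (𝓡 3) m),
    IsSmoothField X → X m = v →
    nkMetric (emb f m) (nablaH f X X X m) (nkJ (emb f m) (dmap f m v)) =
      lam m * (nkMetric (emb f m) (dmap f m v) (dmap f m v)) ^ 2

/-- `f` is `J`-isotropic. -/
def IsJIsotropic [IsManifold (𝓡 3) ∞ M] (f : M → S3 × S3) : Prop := ∃ lam : M → ℝ, IsJIsotropicWith f lam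

/-- The polarized identity with function `lam`, for all vector fields `Y, Z, W, V` tangent to `M`. -/
def PolarizedIdentity [IsManifold (𝓡 3) ∞ M] (f : M → S3 × S3) (lam : M → ℝ) : Prop :=
  ∀ Y Z W V : (∀ m : M, TangentSpace (𝓡 3) m),
    IsSmoothField Y → IsSmoothField Z → IsSmoothField W → IsSmoothField V → ∀ m : M,
    let g := nkMetric (emb f m)
    let J := nkJ (emb f m)
    let P := nkP (emb f m)
    let G := nkG (emb f m)
    -- `d X` is `X`, at `m`, as a tangent vector to `S³ × S³`; `h X Y` is `h(X, Y)` at `m`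
    let d := fun X : (∀ m : M, TangentSpace (𝓡 3) m) => dmap f m (X m)
    let h := fun X Y : (∀ m : M, TangentSpace (𝓡 3) m) => secondFF f X Y m
    12 * g (nablaH f Y Z W m) (J (d V))
      + 3 * cyclicSum (fun Y Z W => g (h Y Z) (G (d W) (d V))) Y Z W
      + 2 * cyclicSum (fun Z W V => g (P (d Y)) (d Z) * g (P (J (d W))) (d V)
          - g (P (J (d Y))) (d Z) * g (P (d W)) (d V)) Z W V
      - 4 * lam m * cyclicSum (fun Z W V => g (d Y) (d Z) * g (d W) (d V)) Z W V = 0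

end NKS3S3

end

/-!
Left multiplication identifies each tangent space of `S³ × S³` with `Im ℍ ⊕ Im ℍ`, on which `g`,
`J`, `P` and the connection have constant coefficients; this turns the curvature of `g` and `∇̃G`
into identities between quaternions.

The left-hand side of the polarized identity is additive in its arguments, and it is totally
symmetric. It is symmetric in `Y, Z` by the Codazzi equation, whose curvature term is matched by the
terms in `P`, and in `Z, W` because `h` is symmetric. The form `g(h(·, ·), J ·)` is totally
symmetric, so interchanging `W` and `V` changes `g((∇h)(Y, Z, W), J V)` only by terms
`g(h(·, ·), G(·, ·))`, which are compensated by the cyclic sum of such terms; here one uses the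
identity obtained by differentiating `g(G(Y, Z), V) = 0` along the Lagrangian submanifold. On the
diagonal the left-hand side is `12 (g((∇h)(v, v, v), J v) - λ g(v, v)²)`, so the equivalence is
polarization.
-/

noncomputable section

namespace NKS3S3

section DirectionalDerivative

open VectorField

variable {E : Type*} [NormedAddCommGroup E] [NormedSpace ℝ E] {H : Type*} [TopologicalSpace H]
  {I : ModelWithCorners ℝ E H} {M : Type*} [TopologicalSpace M] [ChartedSpace H M]
  {F G K : Type*} [NormedAddCommGroup F] [NormedSpace ℝ F] [NormedAddCommGroup G]
  [NormedSpace ℝ G] [NormedAddCommGroup K] [NormedSpace ℝ K] {m : M}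

lemma mvfderiv_clm (L : F →L[ℝ] G) {φ : M → F} (hφ : MDiffAt φ m) (v : TangentSpace I m) :
    d% (fun x => L (φ x)) m v = L (d% φ m v) :=
  congrArg (fun A => A v) (L.hasFDerivAt.hasMFDerivAt.comp m hφ.hasMFDerivAt).mfderiv

lemma mvfderiv_bilin (B : F →L[ℝ] G →L[ℝ] K) {φ : M → F} {ψ : M → G}
    (hφ : MDiffAt φ m) (hψ : MDiffAt ψ m) (v : TangentSpace I m) :
    d% (fun x => B (φ x) (ψ x)) m v = B (d% φ m v) (ψ m) + B (φ m) (d% ψ m v) := by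
  have hB : HasMFDerivAt 𝓘(ℝ, F × G) 𝓘(ℝ, K) (fun p : F × G => B p.1 p.2) (φ m, ψ m) _ :=
    (B.isBoundedBilinearMap.hasFDerivAt (φ m, ψ m)).hasMFDerivAt
  have hpair : HasMFDerivAt I 𝓘(ℝ, F × G) (fun x => (φ x, ψ x)) m _ :=
    ⟨hφ.continuousAt.prodMk hψ.continuousAt, hφ.hasMFDerivAt.2.prodMk hψ.hasMFDerivAt.2⟩
  exact (congrArg (fun A => A v) (hB.comp m hpair).mfderiv).trans (add_comm _ _)

lemma mvfderiv_mem (p : Submodule ℝ F) [IsClosed (p : Set F)] {φ : M → F} (hφ : MDiffAt φ m)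
    (h : ∀ x, φ x ∈ p) (v : TangentSpace I m) : d% φ m v ∈ p := by
  have hp : (fun x => p.mkQL (φ x)) = fun _ => 0 :=
    funext fun x => (Submodule.Quotient.mk_eq_zero p).2 (h x)
  rw [← Submodule.Quotient.mk_eq_zero]
  refine (mvfderiv_clm p.mkQL hφ v).symm.trans ?_
  rw [hp, mvfderiv_const]
  rfl

lemma contMDiff_clm (L : F →L[ℝ] G) {φ : M → F} {n : ℕ∞ω} (hφ : CMDiff n φ) :
    CMDiff n (fun x => L (φ x)) :=
  L.contMDiff.comp hφ

lemma contMDiff_bilin (B : F →L[ℝ] G →L[ℝ] K) {φ : M → F} {ψ : M → G} {n : ℕ∞ω}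
    (hφ : CMDiff n φ) (hψ : CMDiff n ψ) : CMDiff n (fun x => B (φ x) (ψ x)) :=
  (B.contMDiff.comp hφ).clm_apply hψ

variable [IsManifold I ∞ M]

lemma contMDiff_mvfderiv_apply {φ : M → F} (hφ : CMDiff ∞ φ) {X : ∀ x : M, TangentSpace I x}
    (hX : CMDiff ∞ (T% X)) : CMDiff ∞ (fun x => d% φ x (X x)) :=
  (contMDiff_snd_tangentBundle_modelSpace F 𝓘(ℝ, F)).comp
    ((hφ.contMDiff_tangentMap (m := ∞) (by simp)).comp hX)

variable [CompleteSpace E]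

lemma contMDiff_mlieBracket {X Y : ∀ x : M, TangentSpace I x} (hX : CMDiff ∞ (T% X))
    (hY : CMDiff ∞ (T% Y)) : CMDiff ∞ (T% (mlieBracket I X Y)) := by
  have : IsManifold I (minSmoothness ℝ 2) M := by
    rw [minSmoothness_of_isRCLikeNormedField]; infer_instance
  have : IsManifold I ((∞ : ℕ∞ω) + 1) M := ‹IsManifold I ∞ M›
  exact ContDiff.mlieBracket_vectorField (n := (⊤ : ℕ∞)) hX hY (by simp)

lemma mlieBracket_mlieBracket_smul (X : ∀ x : M, TangentSpace I x)
    {Y W : ∀ x : M, TangentSpace I x} (hY : CMDiff ∞ (T% Y)) (hW : CMDiff ∞ (T% W))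
    {φ : M → ℝ} (hφ : CMDiff ∞ φ) (m : M) :
    mlieBracket I X (mlieBracket I Y (φ • W)) m =
      d% (fun x => d% φ x (Y x)) m (X m) • W m + d% φ m (Y m) • mlieBracket I X W m
        + (d% φ m (X m) • mlieBracket I Y W m
          + φ m • mlieBracket I X (mlieBracket I Y W) m) := by
  have leibniz {ψ : M → ℝ} (hψ : CMDiff ∞ ψ) {V : ∀ x : M, TangentSpace I x}
      (hV : CMDiff ∞ (T% V)) (Z : ∀ x : M, TangentSpace I x) :
      mlieBracket I Z (ψ • V) = (fun x => d% ψ x (Z x)) • V + ψ • mlieBracket I Z V :=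
    funext fun x => mlieBracket_smul_right (hψ.mdifferentiable (by simp) x)
      (hV.mdifferentiable (by simp) x)
  have hYφ := contMDiff_mvfderiv_apply hφ hY
  have hYW := contMDiff_mlieBracket hY hW
  rw [leibniz hφ hW, mlieBracket_add_right ((hYφ.smul_section hW).mdifferentiable (by simp) m)
    ((hφ.smul_section hYW).mdifferentiable (by simp) m), leibniz hYφ hW, leibniz hφ hYW]
  rfl

/-- Compare the two expansions of `[X, [Y, φ • W]]` given by the Leibniz rule and by the Jacobi
identity. -/
lemma commutator_smul_eq {X Y W : ∀ x : M, TangentSpace I x} (hX : CMDiff ∞ (T% X))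
    (hY : CMDiff ∞ (T% Y)) (hW : CMDiff ∞ (T% W)) {φ : M → ℝ} (hφ : CMDiff ∞ φ) (m : M) :
    d% φ m (mlieBracket I X Y m) • W m =
      (d% (fun x => d% φ x (Y x)) m (X m) - d% (fun x => d% φ x (X x)) m (Y m)) • W m := by
  have jacobi {Z : ∀ x : M, TangentSpace I x} (hZ : CMDiff ∞ (T% Z)) :
      mlieBracket I X (mlieBracket I Y Z) m =
        mlieBracket I (mlieBracket I X Y) Z m + mlieBracket I Y (mlieBracket I X Z) m := by
    have : IsManifold I (minSmoothness ℝ 3) M := by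
      rw [minSmoothness_of_isRCLikeNormedField]; infer_instance
    have h2 : minSmoothness ℝ 2 ≤ ∞ := by
      rw [minSmoothness_of_isRCLikeNormedField]; exact WithTop.coe_le_coe.2 le_top
    exact leibniz_identity_mlieBracket_apply ((hX m).of_le h2) ((hY m).of_le h2) ((hZ m).of_le h2)
  have h := jacobi (hφ.smul_section hW)
  change _ = mlieBracket I _ (φ • W) m + mlieBracket I _ (mlieBracket I _ (φ • W)) m at h
  rw [mlieBracket_mlieBracket_smul Y hX hW hφ,
    mlieBracket_smul_right (hφ.mdifferentiable (by simp) m) (hW.mdifferentiable (by simp) m)] at h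
  have h' := (mlieBracket_mlieBracket_smul X hY hW hφ m).symm.trans h
  rw [jacobi hW] at h'
  linear_combination (norm := module) -h'

lemma mvfderiv_mlieBracket_real {X Y : ∀ x : M, TangentSpace I x} (hX : CMDiff ∞ (T% X))
    (hY : CMDiff ∞ (T% Y)) {φ : M → ℝ} (hφ : CMDiff ∞ φ) (m : M) :
    d% φ m (mlieBracket I X Y m) =
      d% (fun x => d% φ x (Y x)) m (X m) - d% (fun x => d% φ x (X x)) m (Y m) := by
  by_cases hXm : X m = 0
  · by_cases hYm : Y m = 0
    · rw [← mlieBracketWithin_univ, mlieBracketWithin_eq_zero_of_eq_zero hXm hYm, hXm, hYm]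
      simp
    · exact smul_left_injective ℝ hYm (commutator_smul_eq hX hY hY hφ m)
  · exact smul_left_injective ℝ hXm (commutator_smul_eq hX hY hX hφ m)

lemma mvfderiv_mlieBracket {X Y : ∀ x : M, TangentSpace I x} (hX : CMDiff ∞ (T% X))
    (hY : CMDiff ∞ (T% Y)) {φ : M → F} (hφ : CMDiff ∞ φ) (m : M) :
    d% φ m (mlieBracket I X Y m) =
      d% (fun x => d% φ x (Y x)) m (X m) - d% (fun x => d% φ x (X x)) m (Y m) := by
  refine (SeparatingDual.eq_iff_forall_dual_eq (R := ℝ)).2 fun L => ?_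
  have hL {ψ : M → F} (hψ : CMDiff ∞ ψ) (x : M) (v : TangentSpace I x) :
      L (d% ψ x v) = d% (fun y => L (ψ y)) x v :=
    (mvfderiv_clm L (hψ.mdifferentiable (by simp) x) v).symm
  simp only [map_sub, hL hφ, hL (contMDiff_mvfderiv_apply hφ hX),
    hL (contMDiff_mvfderiv_apply hφ hY)]
  exact mvfderiv_mlieBracket_real hX hY (contMDiff_clm L hφ) m

end DirectionalDerivative

section OrthogonalProjection

variable {E : Type*} [NormedAddCommGroup E] [NormedSpace ℝ E] {H : Type*} [TopologicalSpace H]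
  {I : ModelWithCorners ℝ E H} {M : Type*} [TopologicalSpace M] [ChartedSpace H M]
  {F V : Type*} [NormedAddCommGroup F] [NormedSpace ℝ F] [NormedAddCommGroup V] [NormedSpace ℝ V]
  [FiniteDimensional ℝ V] {m : M}

/-- `c` solves the normal equations, whose Gram operator is invertible near `m`. -/
lemma exists_contMDiffAt_orthogonal_sub (B : F →L[ℝ] F →L[ℝ] ℝ) (hB : ∀ a, B a a = 0 → a = 0)
    {n : ℕ∞ω} {e : M → V →L[ℝ] F} (he : CMDiffAt n e m) (hinj : Function.Injective (e m))
    {φ : M → F} (hφ : CMDiffAt n φ m) :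
    ∃ c : M → V, CMDiffAt n c m ∧ ∀ᶠ x in nhds m, ∀ w, B (φ x - e x (c x)) (e x w) = 0 := by
  let pre (x : M) : (F →L[ℝ] ℝ) →L[ℝ] (V →L[ℝ] ℝ) := (e x).precomp ℝ
  let gram (x : M) : V →L[ℝ] (V →L[ℝ] ℝ) := (pre x).comp (B.comp (e x))
  have hpre : CMDiffAt n pre m := he.clm_precomp
  have hgram : CMDiffAt n gram m := hpre.clm_comp ((contMDiffAt_const (c := B)).clm_comp he)
  have gram_injective : Function.Injective (gram m) :=
    (injective_iff_map_eq_zero _).2 fun v hv =>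
      (map_eq_zero_iff _ hinj).1 (hB _ (congrArg (fun A : V →L[ℝ] ℝ => A v) hv))
  have hdim : Module.finrank ℝ V = Module.finrank ℝ (V →L[ℝ] ℝ) := by
    rw [← LinearMap.toContinuousLinearMap.finrank_eq]
    exact Subspace.dual_finrank_eq.symm
  let gramEquiv : V ≃L[ℝ] (V →L[ℝ] ℝ) :=
    (LinearEquiv.ofInjectiveOfFinrankEq (gram m) gram_injective hdim).toContinuousLinearEquiv
  have hgramEquiv : (gramEquiv : V →L[ℝ] (V →L[ℝ] ℝ)) = gram m := rfl
  have hinv : ContDiffAt ℝ n ContinuousLinearMap.inverse (gram m) :=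
    hgramEquiv ▸ contDiffAt_map_inverse gramEquiv
  refine ⟨fun x => (gram x).inverse (pre x (B (φ x))), (hinv.comp_contMDiffAt hgram).clm_apply
    (hpre.clm_apply (B.contMDiff.contMDiffAt.comp m hφ)), ?_⟩
  have hnhds : Set.range ((↑) : (V ≃L[ℝ] (V →L[ℝ] ℝ)) → V →L[ℝ] (V →L[ℝ] ℝ)) ∈ nhds (gram m) :=
    hgramEquiv ▸ gramEquiv.nhds
  filter_upwards [hgram.continuousAt.preimage_mem_nhds hnhds] with x ⟨A, hA⟩ w
  have h : gram x ((gram x).inverse (pre x (B (φ x)))) = pre x (B (φ x)) := by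
    rw [← hA, ContinuousLinearMap.inverse_equiv]
    exact A.apply_symm_apply _
  rw [map_sub, sub_apply, sub_eq_zero]
  exact (congrArg (fun A : V →L[ℝ] ℝ => A w) h).symm

end OrthogonalProjection

section LieAlgebra

/-- The Lie algebra `Im ℍ ⊕ Im ℍ` of `S³ × S³`. -/
def imPairs : Submodule ℝ HH where
  carrier := {a | a.1.re = 0 ∧ a.2.re = 0}
  add_mem' ha hb := by simp [ha.1, ha.2, hb.1, hb.2]
  zero_mem' := ⟨rfl, rfl⟩
  smul_mem' r a ha := by simp [ha.1, ha.2]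

/-- The metric `g` in the left trivialization. -/
def lieMetric : HH →L[ℝ] HH →L[ℝ] ℝ :=
  (LinearMap.mk₂ ℝ metric0 metric0_add_left
    (fun c a b => by
      simp only [metric0, Prod.smul_fst, Prod.smul_snd, real_inner_smul_left, smul_eq_mul]; ring)
    metric0_add_right
    (fun c a b => by
      simp only [metric0, Prod.smul_fst, Prod.smul_snd, real_inner_smul_right, smul_eq_mul]
      ring)).toContinuousBilinearMap

/-- The Levi-Civita connection of `g` on left-invariant fields. -/
def lieConn : HH →L[ℝ] HH →L[ℝ] HH :=
  (LinearMap.mk₂ ℝ coeff coeff_add_left coeff_smul_left coeff_add_right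
    coeff_smul_right).toContinuousBilinearMap

/-- The tensor `√3 J` in the left trivialization. -/
def lieSqrtThreeJ : HH →L[ℝ] HH :=
  ((2 : ℝ) • ContinuousLinearMap.snd ℝ ℍ ℍ - ContinuousLinearMap.fst ℝ ℍ ℍ).prod
    (ContinuousLinearMap.snd ℝ ℍ ℍ - (2 : ℝ) • ContinuousLinearMap.fst ℝ ℍ ℍ)

/-- The almost complex structure `J` in the left trivialization. -/
def lieJ : HH →L[ℝ] HH := (1 / Real.sqrt 3) • lieSqrtThreeJ

/-- The almost product structure `P` in the left trivialization. -/
def lieP : HH →L[ℝ] HH := (ContinuousLinearMap.snd ℝ ℍ ℍ).prod (ContinuousLinearMap.fst ℝ ℍ ℍ)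

/-- The tensor `G = ∇̃J` in the left trivialization. -/
def lieG : HH →L[ℝ] HH →L[ℝ] HH :=
  lieConn.bilinearComp (.id ℝ HH) lieJ - (ContinuousLinearMap.compL ℝ HH HH HH lieJ).comp lieConn

lemma lieMetric_apply (a b : HH) : lieMetric a b =
    4 / 3 * (inner ℝ a.1 b.1 + inner ℝ a.2 b.2) - 2 / 3 * (inner ℝ a.1 b.2 + inner ℝ a.2 b.1) :=
  rfl

lemma lieConn_apply (a b : HH) : lieConn a b = coeff a b := rfl

lemma lieJ_apply (a : HH) : lieJ a = (1 / Real.sqrt 3) • lieSqrtThreeJ a := rfl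

lemma lieSqrtThreeJ_apply (a : HH) : lieSqrtThreeJ a = ((2 : ℝ) • a.2 - a.1, a.2 - (2 : ℝ) • a.1) :=
  rfl

lemma lieP_apply (a : HH) : lieP a = (a.2, a.1) := rfl

lemma lieG_apply (a b : HH) : lieG a b = lieConn a (lieJ b) - lieJ (lieConn a b) := rfl

lemma lieMetric_comm (a b : HH) : lieMetric a b = lieMetric b a := metric0_comm a b

lemma lieMetric_lieConn (a b c : HH) :
    lieMetric (lieConn a b) c = -lieMetric b (lieConn a c) :=
  eq_neg_of_add_eq_zero_left (metric0_coeff a b c)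

lemma inv_sqrt_three_mul_self : (1 / Real.sqrt 3) * (1 / Real.sqrt 3) = 1 / 3 := by
  rw [div_mul_div_comm, Real.mul_self_sqrt (by norm_num), one_mul]

lemma lieJ_lieJ (a : HH) : lieJ (lieJ a) = -a := by
  have h : lieSqrtThreeJ (lieSqrtThreeJ a) = (-3 : ℝ) • a := by
    ext1 <;> simp only [lieSqrtThreeJ_apply, Prod.smul_fst, Prod.smul_snd] <;> module
  rw [lieJ_apply, lieJ_apply, map_smul, smul_smul, inv_sqrt_three_mul_self, h]
  module

lemma lieMetric_lieJ_left (a b : HH) : lieMetric (lieJ a) b = -lieMetric a (lieJ b) := by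
  simp only [lieJ_apply, lieSqrtThreeJ_apply, map_smul, smul_apply,
    lieMetric_apply, inner_sub_left, inner_sub_right, real_inner_smul_left, real_inner_smul_right,
    smul_eq_mul]
  ring

lemma lieMetric_lieJ_lieJ (a b : HH) : lieMetric (lieJ a) (lieJ b) = lieMetric a b := by
  rw [lieMetric_lieJ_left, lieJ_lieJ, map_neg, neg_neg]

lemma lieP_lieJ (a : HH) : lieP (lieJ a) = -lieJ (lieP a) := by
  ext1 <;> simp only [lieP_apply, lieJ_apply, lieSqrtThreeJ_apply, Prod.smul_fst, Prod.smul_snd,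
    Prod.fst_neg, Prod.snd_neg] <;> module

lemma lieMetric_lieP_left (a b : HH) : lieMetric (lieP a) b = lieMetric a (lieP b) := by
  simp only [lieMetric_apply, lieP_apply]
  ring

/-- The symmetric form `g(P x, y)`. -/
def formP (x y : HH) : ℝ := lieMetric (lieP x) y

/-- The symmetric form `g(P J x, y)`. -/
def formPJ (x y : HH) : ℝ := lieMetric (lieP (lieJ x)) y

lemma formP_comm (x y : HH) : formP x y = formP y x := by
  rw [formP, lieMetric_lieP_left, lieMetric_comm, formP]

lemma formPJ_comm (x y : HH) : formPJ x y = formPJ y x := by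
  rw [formPJ, lieMetric_lieP_left, lieMetric_lieJ_left, lieMetric_comm, formPJ, lieP_lieJ, map_neg,
    neg_apply]

lemma lieMetric_lieP_lieJ (x y : HH) : lieMetric (lieP x) (lieJ y) = formPJ x y := by
  rw [formPJ, lieP_lieJ, map_neg, neg_apply, lieMetric_lieJ_left, neg_neg]

lemma lieMetric_lieG_right (a b c : HH) : lieMetric (lieG a b) c = -lieMetric b (lieG a c) := by
  simp only [lieG_apply, map_sub, sub_apply, lieMetric_lieConn,
    lieMetric_lieJ_left]
  ring

/-- The cross product `cross` as a continuous bilinear map. -/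
def crossBilin : ℍ →L[ℝ] ℍ →L[ℝ] ℍ :=
  (1 / 2 : ℝ) • (ContinuousLinearMap.mul ℝ ℍ - (ContinuousLinearMap.mul ℝ ℍ).flip)

lemma crossBilin_swap (a b : ℍ) : crossBilin a b = -crossBilin b a := by
  change (1 / 2 : ℝ) • (a * b - b * a) = -((1 / 2 : ℝ) • (b * a - a * b))
  module

lemma crossBilin_crossBilin (a : ℍ) {b c : ℍ} (hb : b.re = 0) (hc : c.re = 0) :
    crossBilin a (crossBilin b c) = inner ℝ a c • b - inner ℝ a b • c := by
  change (1 / 2 : ℝ) • (a * ((1 / 2 : ℝ) • (b * c - c * b)) - (1 / 2 : ℝ) • (b * c - c * b) * a) = _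
  ext <;> simp [Quaternion.inner_def, hb, hc] <;> ring

lemma lieConn_eq (a b : HH) : lieConn a b =
    (crossBilin a.1 b.1 + (1 / 3 : ℝ) • (crossBilin a.2 b.1 - crossBilin a.1 b.2),
      crossBilin a.2 b.2 + (1 / 3 : ℝ) • (crossBilin a.1 b.2 - crossBilin a.2 b.1)) :=
  rfl

lemma lieG_swap (a b : HH) : lieG a b = -lieG b a := by
  ext1 <;> simp only [lieG_apply, lieConn_eq, lieJ_apply, lieSqrtThreeJ_apply, Prod.smul_fst,
    Prod.smul_snd, Prod.fst_sub, Prod.snd_sub, Prod.fst_neg, Prod.snd_neg, map_sub, map_smul,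
    crossBilin_swap b.1, crossBilin_swap b.2,
    sub_apply, smul_apply] <;> module

lemma crossBilin_crossBilin_left {a b : ℍ} (ha : a.re = 0) (hb : b.re = 0) (c : ℍ) :
    crossBilin (crossBilin a b) c = inner ℝ a c • b - inner ℝ b c • a := by
  rw [crossBilin_swap, crossBilin_crossBilin c ha hb, real_inner_comm c, real_inner_comm c, neg_sub]

lemma lieMetric_lieG_left (a b c : HH) : lieMetric (lieG a b) c = lieMetric a (lieG b c) := by
  rw [lieG_swap, map_neg, neg_apply, lieMetric_lieG_right, neg_neg]

lemma lieConn_lieG {x b c : HH} (hx : x ∈ imPairs) (hb : b ∈ imPairs) (hc : c ∈ imPairs) :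
    lieConn x (lieG b c) - lieG (lieConn x b) c - lieG b (lieConn x c) =
      (1 / 3 : ℝ) • (lieMetric x c • lieJ b - lieMetric x b • lieJ c
        - lieMetric (lieJ b) c • x) := by
  ext1 <;> simp only [lieG_apply, lieConn_eq, lieJ_apply, lieSqrtThreeJ_apply, Prod.smul_fst,
    Prod.smul_snd, Prod.fst_sub, Prod.snd_sub, map_sub, map_add, map_smul, add_apply, sub_apply,
    smul_apply, crossBilin_crossBilin, crossBilin_crossBilin_left, hx.1, hx.2, hb.1, hb.2, hc.1,
    hc.2, lieMetric_apply, inner_sub_left, real_inner_smul_right, smul_eq_mul,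
    real_inner_comm] <;> module

lemma lieMetric_lieJ_smul_lieJ (a b c : HH) : lieMetric (lieJ a) b • lieJ c =
    (1 / 3 : ℝ) • lieMetric (lieSqrtThreeJ a) b • lieSqrtThreeJ c := by
  rw [lieJ_apply, lieJ_apply, map_smul, smul_apply, smul_eq_mul, smul_smul, mul_right_comm,
    inv_sqrt_three_mul_self, smul_smul]

/-- The curvature tensor of `g` in the left trivialization. -/
def lieCurv (a b c : HH) : HH :=
  lieConn a (lieConn b c) - lieConn b (lieConn a c) - lieConn (a * b - b * a) c

lemma mul_sub_mul_eq (a b : HH) :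
    a * b - b * a = ((2 : ℝ) • crossBilin a.1 b.1, (2 : ℝ) • crossBilin a.2 b.2) := by
  change _ = ((2 : ℝ) • cross a.1 b.1, (2 : ℝ) • cross a.2 b.2)
  ext1 <;> simp only [cross, Prod.fst_sub, Prod.snd_sub, Prod.fst_mul, Prod.snd_mul] <;> module

lemma lieCurv_eq {a b c : HH} (ha : a ∈ imPairs) (hb : b ∈ imPairs) (hc : c ∈ imPairs) :
    lieCurv a b c =
    (5 / 12 : ℝ) • (lieMetric b c • a - lieMetric a c • b)
    + (1 / 12 : ℝ) • (lieMetric (lieJ b) c • lieJ a - lieMetric (lieJ a) c • lieJ b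
      - (2 : ℝ) • lieMetric (lieJ a) b • lieJ c)
    + (1 / 3 : ℝ) • (lieMetric (lieP b) c • lieP a - lieMetric (lieP a) c • lieP b
      + lieMetric (lieJ (lieP b)) c • lieJ (lieP a)
      - lieMetric (lieJ (lieP a)) c • lieJ (lieP b)) := by
  rw [lieCurv, mul_sub_mul_eq]
  simp only [lieMetric_lieJ_smul_lieJ]
  ext1 <;> simp only [lieConn_eq, lieSqrtThreeJ_apply, lieP_apply, Prod.smul_fst,
    Prod.smul_snd, Prod.fst_add, Prod.snd_add, Prod.fst_sub, Prod.snd_sub, map_sub, map_add,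
    map_smul, smul_apply, crossBilin_crossBilin, crossBilin_crossBilin_left,
    ha.1, ha.2, hb.1, hb.2, hc.1, hc.2, lieMetric_apply, inner_sub_left, real_inner_smul_right,
    real_inner_comm] <;> module

end LieAlgebra

section LeftTrivialization

lemma lieConn_mem_imPairs (a b : HH) : lieConn a b ∈ imPairs := coeff_re a b

lemma lieJ_mem_imPairs {a : HH} (ha : a ∈ imPairs) : lieJ a ∈ imPairs := by
  refine Submodule.smul_mem _ _ ⟨?_, ?_⟩ <;> simp [lieSqrtThreeJ_apply, ha.1, ha.2]

lemma leftMul_sub (x a b : HH) : leftMul x (a - b) = leftMul x a - leftMul x b := by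
  ext1 <;> simp [leftMul, mul_sub]

lemma nkMetric_leftMul_eq {x : HH} (hx : x ∈ S3xS3) (a b : HH) :
    nkMetric x (leftMul x a) (leftMul x b) = lieMetric a b :=
  nkMetric_leftMul hx a b

lemma nkJ_leftMul_eq {x : HH} (hx : x ∈ S3xS3) (a : HH) :
    nkJ x (leftMul x a) = leftMul x (lieJ a) := by
  rw [nkJ_leftMul hx, neg_add_eq_sub]
  rfl

lemma nkP_leftMul {x : HH} (hx : x ∈ S3xS3) (a : HH) :
    nkP x (leftMul x a) = leftMul x (lieP a) := by
  obtain ⟨h1, h2⟩ := ne_zero_of_mem hx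
  ext1 <;> simp [nkP, leftMul, lieP_apply, mul_assoc, h1, h2]

lemma contDiffAt_uncurry_leftTriv {p : HH × HH} (hp : p.1 ∈ S3xS3) :
    ContDiffAt ℝ ∞ (fun p : HH × HH => leftTriv p.1 p.2) p := by
  have contDiffAt_quaternion_inv {a : ℍ} (ha : a ≠ 0) : ContDiffAt ℝ ∞ (fun z : ℍ => z⁻¹) a := by
    have h := contDiffAt_ringInverse ℝ (n := ∞) (Units.mk0 a ha)
    rwa [Ring.inverse_eq_inv'] at h
  obtain ⟨h1, h2⟩ := ne_zero_of_mem hp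
  have e1 : ContDiffAt ℝ ∞ (fun p : HH × HH => p.1.1⁻¹) p :=
    (contDiffAt_quaternion_inv h1).comp p (f := fun p : HH × HH => p.1.1) (by fun_prop)
  have e2 : ContDiffAt ℝ ∞ (fun p : HH × HH => p.1.2⁻¹) p :=
    (contDiffAt_quaternion_inv h2).comp p (f := fun p : HH × HH => p.1.2) (by fun_prop)
  exact (e1.mul contDiffAt_snd.fst).prodMk (e2.mul contDiffAt_snd.snd)

lemma isVectorField_leftInv {a : HH} (ha : a ∈ imPairs) : IsVectorField (leftInv a) :=
  leftInv_isVectorField ha.1 ha.2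

/-- A field that agrees with a left-invariant one along `S³ × S³` has constant left
trivialization there. -/
lemma leviCivita_leftInv_of_eqOn {Y : HH → HH} {x a b : HH} (hx : x ∈ S3xS3) (ha : a ∈ imPairs)
    (hY : IsVectorField Y) (hYb : ∀ y ∈ S3xS3, Y y = leftMul y b) :
    leviCivita (leftInv a) Y x = leftMul x (lieConn a b) := by
  have h : fderiv ℝ (fun y => leftTriv y (Y y)) x (leftInv a x) = 0 := by
    rw [fderiv_congr hx ((isVectorField_leftInv ha).tangent x hx) (hY.differentiableAt_leftTriv hx)
      (differentiableAt_const b) fun y hy => by rw [hYb y hy, leftTriv_leftMul hy]]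
    simp
  rw [leviCivita_eq_connFormula (isVectorField_leftInv ha) hY hx, connFormula, h, zero_add,
    hYb x hx, leftInv, leftTriv_leftMul hx, leftTriv_leftMul hx, lieConn_apply]

lemma leviCivita_leftInv {x a b : HH} (hx : x ∈ S3xS3) (ha : a ∈ imPairs) (hb : b ∈ imPairs) :
    leviCivita (leftInv a) (leftInv b) x = leftMul x (lieConn a b) :=
  leviCivita_leftInv_of_eqOn hx ha (isVectorField_leftInv hb) fun _ _ => rfl

lemma isVectorField_nkJ_leftInv {b : HH} (hb : b ∈ imPairs) :
    IsVectorField (fun y => nkJ y (leftInv b y)) where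
  smooth y hy := by
    have h := isVectorField_leftInv hb
    have hW := h.smooth y hy
    have hV := contDiffAt_leftTriv hy hW
    have eq_leftTriv : (fun y => nkJ y (leftInv b y)) = fun y =>
        ((1 / Real.sqrt 3) • ((2 : ℝ) • (y.1 * (leftTriv y (leftInv b y)).2) - (leftInv b y).1),
          (1 / Real.sqrt 3) •
            (-((2 : ℝ) • (y.2 * (leftTriv y (leftInv b y)).1)) + (leftInv b y).2)) := by
      funext y
      simp only [nkJ, leftTriv, mul_assoc]
    rw [eq_leftTriv]
    have hV1 := hV.fst
    have hV2 := hV.snd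
    fun_prop
  tangent y hy := by
    rw [leftInv, nkJ_leftMul_eq hy]
    exact (isTangent_leftMul_iff hy _).2 (lieJ_mem_imPairs hb)

lemma nkG_leftMul {x a b : HH} (hx : x ∈ S3xS3) (ha : a ∈ imPairs) (hb : b ∈ imPairs) :
    nkG x (leftMul x a) (leftMul x b) = leftMul x (lieG a b) := by
  rw [nkG, leftTriv_leftMul hx, leftTriv_leftMul hx, leviCivita_leftInv hx ha hb,
    nkJ_leftMul_eq hx, leviCivita_leftInv_of_eqOn hx ha (isVectorField_nkJ_leftInv hb)
      fun y hy => nkJ_leftMul_eq hy b, ← leftMul_sub, lieG_apply]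

end LeftTrivialization

section LagrangianImmersion

variable {M : Type*} [TopologicalSpace M] [ChartedSpace (EuclideanSpace ℝ (Fin 3)) M]
  {f : M → S3 × S3}

/-- The differential of `f` in the left trivialization. -/
def lieMap (f : M → S3 × S3) (m : M) : TangentSpace (𝓡 3) m →ₗ[ℝ] HH where
  toFun v := leftTriv (emb f m) (dmap f m v)
  map_add' v w := by rw [← leftTriv_add, dmap, map_add]; rfl
  map_smul' r v := by rw [RingHom.id_apply, ← leftTriv_smul, dmap, map_smul]; rfl

lemma leftMul_lieMap (f : M → S3 × S3) (m : M) (v : TangentSpace (𝓡 3) m) :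
    leftMul (emb f m) (lieMap f m v) = dmap f m v :=
  leftMul_leftTriv (emb_mem f m) _

namespace IsLagrangianImmersion

lemma contMDiff_emb (hf : IsLagrangianImmersion f) :
    ContMDiff (𝓡 3) 𝓘(ℝ, HH) ∞ (emb f) :=
  (contMDiff_coe_sphere.comp (contMDiff_fst.comp hf.smooth)).prodMk_space
    (contMDiff_coe_sphere.comp (contMDiff_snd.comp hf.smooth))

lemma contMDiff_leftTriv (hf : IsLagrangianImmersion f) {V : M → HH}
    (hV : ContMDiff (𝓡 3) 𝓘(ℝ, HH) ∞ V) :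
    ContMDiff (𝓡 3) 𝓘(ℝ, HH) ∞ (fun m => leftTriv (emb f m) (V m)) := fun m =>
  (contDiffAt_uncurry_leftTriv (p := (emb f m, V m)) (emb_mem f m)).comp_contMDiffAt (x := m)
    ((hf.contMDiff_emb.prodMk_space hV) m)

lemma isTangent_dmap (hf : IsLagrangianImmersion f) (m : M) (v : TangentSpace (𝓡 3) m) :
    IsTangent (emb f m) (dmap f m v) := by
  have inner_eq_zero (L : HH →L[ℝ] ℍ) (hL : ∀ m, ‖L (emb f m)‖ = 1) :
      inner ℝ (L (emb f m)) (L (dmap f m v)) = 0 := by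
    have hemb := hf.contMDiff_emb.mdifferentiable (by simp) m
    have hLemb := (contMDiff_clm L hf.contMDiff_emb).mdifferentiable (by simp) m
    have h := mvfderiv_bilin (innerSL ℝ) hLemb hLemb v
    have hconst : (fun m => innerSL ℝ (L (emb f m)) (L (emb f m))) = fun _ => (1 : ℝ) :=
      funext fun m => by rw [innerSL_apply_apply, real_inner_self_eq_norm_sq, hL, one_pow]
    rw [hconst, mvfderiv_const, mvfderiv_clm L hemb, innerSL_apply_apply, innerSL_apply_apply,
      real_inner_comm] at h
    change 0 = inner ℝ (L (emb f m)) (L (dmap f m v)) + inner ℝ (L (emb f m)) (L (dmap f m v)) at h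
    linarith
  exact ⟨inner_eq_zero (.fst ℝ ℍ ℍ) fun m => (emb_mem f m).1,
    inner_eq_zero (.snd ℝ ℍ ℍ) fun m => (emb_mem f m).2⟩

lemma lieMap_mem_imPairs (hf : IsLagrangianImmersion f) (m : M) (v : TangentSpace (𝓡 3) m) :
    lieMap f m v ∈ imPairs :=
  re_leftTriv (emb_mem f m) (hf.isTangent_dmap m v)

lemma lieMap_injective (hf : IsLagrangianImmersion f) (m : M) :
    Function.Injective (lieMap f m) := fun v w h =>
  hf.immersion m (by rw [← leftMul_lieMap, ← leftMul_lieMap, h])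

lemma lieMetric_lieJ_lieMap (hf : IsLagrangianImmersion f) (m : M) (v w : TangentSpace (𝓡 3) m) :
    lieMetric (lieJ (lieMap f m v)) (lieMap f m w) = 0 := by
  have h := ((hf.lagrangian m _).1 ⟨v, rfl⟩).2 w
  rwa [← leftMul_lieMap, ← leftMul_lieMap, nkJ_leftMul_eq (emb_mem f m),
    nkMetric_leftMul_eq (emb_mem f m)] at h

lemma exists_eq_lieJ_lieMap (hf : IsLagrangianImmersion f) {m : M} {a : HH} (ha : a ∈ imPairs)
    (h : ∀ w, lieMetric a (lieMap f m w) = 0) : ∃ u, a = lieJ (lieMap f m u) := by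
  have hx := emb_mem f m
  obtain ⟨u, hu⟩ := (hf.lagrangian m (leftMul (emb f m) a)).2
    ⟨(isTangent_leftMul_iff hx a).2 ha, fun w => by
      rw [← leftMul_lieMap, nkMetric_leftMul_eq hx]; exact h w⟩
  rw [← leftMul_lieMap, nkJ_leftMul_eq hx] at hu
  exact ⟨u, by rw [← leftTriv_leftMul hx a, hu, leftTriv_leftMul hx]⟩

lemma tanPart_eq (hf : IsLagrangianImmersion f) {m : M} {a : HH} {u : TangentSpace (𝓡 3) m}
    (hu : ∀ w, lieMetric (a - lieMap f m u) (lieMap f m w) = 0) :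
    tanPart f m (leftMul (emb f m) a) = u := by
  have nkMetric_sub (u w) : nkMetric (emb f m) (leftMul (emb f m) a - dmap f m u) (dmap f m w) =
      lieMetric (a - lieMap f m u) (lieMap f m w) := by
    rw [← leftMul_lieMap, ← leftMul_lieMap, ← leftMul_sub, nkMetric_leftMul_eq (emb_mem f m)]
  have hex : ∃ u, ∀ w, nkMetric (emb f m) (leftMul (emb f m) a - dmap f m u) (dmap f m w) = 0 :=
    ⟨u, fun w => (nkMetric_sub u w).trans (hu w)⟩
  rw [tanPart, dif_pos hex]
  set t := Classical.choose hex
  have ht (w) : lieMetric (a - lieMap f m t) (lieMap f m w) = 0 :=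
    (nkMetric_sub t w).symm.trans (Classical.choose_spec hex w)
  refine hf.lieMap_injective m (sub_eq_zero.1 (metric0_self_pos ?_))
  have h : lieMetric (lieMap f m t - lieMap f m u) (lieMap f m (t - u)) = 0 := by
    rw [← sub_sub_sub_cancel_left _ _ a, map_sub lieMetric, sub_apply, hu, ht, sub_zero]
  rwa [map_sub (lieMap f m)] at h

variable [IsManifold (𝓡 3) ∞ M]

lemma contMDiff_lieMap (hf : IsLagrangianImmersion f) {X : ∀ m : M, TangentSpace (𝓡 3) m}
    (hX : IsSmoothField X) : ContMDiff (𝓡 3) 𝓘(ℝ, HH) ∞ (fun m => lieMap f m (X m)) :=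
  hf.contMDiff_leftTriv (contMDiff_mvfderiv_apply hf.contMDiff_emb hX)

variable [T2Space M]

lemma exists_local_tanPart (hf : IsLagrangianImmersion f) {φ : M → HH} {m : M}
    (hφ : ContMDiffAt (𝓡 3) 𝓘(ℝ, HH) ∞ φ m) :
    ∃ Y : ∀ m : M, TangentSpace (𝓡 3) m, ContMDiffAt (𝓡 3) (𝓡 3).tangent ∞ (T% Y) m ∧
      ∀ᶠ x in nhds m, ∀ w, lieMetric (φ x - lieMap f x (Y x)) (lieMap f x w) = 0 := by
  let b := EuclideanSpace.basisFun (Fin 3) ℝ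
  choose X hX hXm using fun i : Fin 3 => exists_isSmoothField m (b i : TangentSpace (𝓡 3) m)
  let comb (x : M) : EuclideanSpace ℝ (Fin 3) →ₗ[ℝ] TangentSpace (𝓡 3) x :=
    ∑ i, (EuclideanSpace.projₗ i).smulRight (X i x)
  let frame (x : M) : EuclideanSpace ℝ (Fin 3) →L[ℝ] HH :=
    ∑ i, (EuclideanSpace.proj i).smulRight (lieMap f x (X i x))
  have comb_apply (x c) : comb x c = ∑ i, c i • X i x := LinearMap.sum_apply _ _ _
  have frame_apply (x c) : frame x c = lieMap f x (comb x c) := by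
    rw [comb_apply, map_sum, sum_apply]
    exact Finset.sum_congr rfl fun i _ => (map_smul (lieMap f x) (c i) (X i x)).symm
  have comb_self (c) : comb m c = c := by
    simp only [comb_apply, hXm]
    exact b.sum_repr c
  have frame_injective : Function.Injective (frame m) := fun c d h => by
    rw [frame_apply, frame_apply, comb_self, comb_self] at h
    exact hf.lieMap_injective m h
  have frame_smooth : ContMDiffAt (𝓡 3) 𝓘(ℝ, _) ∞ frame m :=
    contMDiffAt_finsetSum fun i _ => contMDiff_clm
      (ContinuousLinearMap.smulRightL ℝ _ HH (EuclideanSpace.proj i)) (hf.contMDiff_lieMap (hX i)) m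
  obtain ⟨c, hc, hcφ⟩ := exists_contMDiffAt_orthogonal_sub lieMetric
    (fun _ => metric0_self_pos) frame_smooth frame_injective hφ
  have coeff_smooth (i : Fin 3) : ContMDiffAt (𝓡 3) 𝓘(ℝ, ℝ) ∞ (fun x => c x i) m :=
    (EuclideanSpace.proj i : EuclideanSpace ℝ (Fin 3) →L[ℝ] ℝ).contMDiff.contMDiffAt.comp m hc
  refine ⟨fun x => ∑ i, c x i • X i x, ContMDiffAt.sum_section fun i _ =>
    (coeff_smooth i).smul_section (hX i m), ?_⟩
  filter_upwards [hcφ, frame_smooth.continuousAt.eventually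
    (ContinuousLinearMap.isOpen_injective.mem_nhds frame_injective)] with x hx hinj w
  have comb_injective : Function.Injective (comb x) := fun c d h =>
    hinj (by rw [frame_apply, frame_apply, h])
  obtain ⟨d, rfl⟩ : ∃ d, comb x d = w := LinearMap.injective_iff_surjective.1 comb_injective w
  rw [← comb_apply, ← frame_apply, ← frame_apply]
  exact hx d

lemma lieMetric_sub_tanPart (hf : IsLagrangianImmersion f) (m : M) (a : HH)
    (w : TangentSpace (𝓡 3) m) :
    lieMetric (a - lieMap f m (tanPart f m (leftMul (emb f m) a))) (lieMap f m w) = 0 := by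
  obtain ⟨Y, -, hY⟩ := hf.exists_local_tanPart (contMDiffAt_const (c := a) (x := m))
  rw [hf.tanPart_eq hY.self_of_nhds]
  exact hY.self_of_nhds w

lemma isSmoothField_tanPart (hf : IsLagrangianImmersion f) {φ : M → HH}
    (hφ : ContMDiff (𝓡 3) 𝓘(ℝ, HH) ∞ φ) :
    IsSmoothField (fun m => tanPart f m (leftMul (emb f m) (φ m))) := fun m => by
  obtain ⟨Y, hYsmooth, hY⟩ := hf.exists_local_tanPart (hφ m)
  refine hYsmooth.congr_of_eventuallyEq ?_
  filter_upwards [hY] with x hx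
  rw [hf.tanPart_eq hx]

end IsLagrangianImmersion

end LagrangianImmersion

section PullbackConnection

variable {M : Type*} [TopologicalSpace M] [ChartedSpace (EuclideanSpace ℝ (Fin 3)) M]
  {f : M → S3 × S3} {X Y Z W : ∀ m : M, TangentSpace (𝓡 3) m} {φ ψ : M → HH} {m : M}

/-- A vector field on `M` in the left trivialization. -/
abbrev lieField (f : M → S3 × S3) (X : ∀ m : M, TangentSpace (𝓡 3) m) (m : M) : HH :=
  lieMap f m (X m)

/-- The pull-back connection in the left trivialization. -/
def cov (f : M → S3 × S3) (X : ∀ m : M, TangentSpace (𝓡 3) m) (φ : M → HH) (m : M) : HH :=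
  mvfderiv (𝓡 3) φ m (X m) + lieConn (lieField f X m) (φ m)

lemma cov_mem_imPairs (hφ : MDifferentiableAt (𝓡 3) 𝓘(ℝ, HH) φ m) (h : ∀ x, φ x ∈ imPairs) :
    cov f X φ m ∈ imPairs := by
  have : IsClosed (imPairs : Set HH) := Submodule.closed_of_finiteDimensional _
  exact imPairs.add_mem (mvfderiv_mem imPairs hφ h (X m)) (lieConn_mem_imPairs _ _)

lemma cov_sub (hφ : MDifferentiableAt (𝓡 3) 𝓘(ℝ, HH) φ m)
    (hψ : MDifferentiableAt (𝓡 3) 𝓘(ℝ, HH) ψ m) :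
    cov f X (fun x => φ x - ψ x) m = cov f X φ m - cov f X ψ m := by
  rw [cov, mvfderiv_fun_sub hφ hψ, sub_apply, map_sub, cov, cov]
  abel

lemma mvfderiv_lieMetric (hφ : MDifferentiableAt (𝓡 3) 𝓘(ℝ, HH) φ m)
    (hψ : MDifferentiableAt (𝓡 3) 𝓘(ℝ, HH) ψ m) :
    mvfderiv (𝓡 3) (fun x => lieMetric (φ x) (ψ x)) m (X m) =
      lieMetric (cov f X φ m) (ψ m) + lieMetric (φ m) (cov f X ψ m) := by
  rw [mvfderiv_bilin lieMetric hφ hψ]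
  simp only [cov, map_add, add_apply, lieMetric_lieConn]
  ring

lemma cov_lieJ (hφ : MDifferentiableAt (𝓡 3) 𝓘(ℝ, HH) φ m) :
    cov f X (fun x => lieJ (φ x)) m = lieJ (cov f X φ m) + lieG (lieField f X m) (φ m) := by
  rw [cov, mvfderiv_clm lieJ hφ, lieG_apply, cov, map_add]
  abel

/-- The second fundamental form in the left trivialization. -/
def lieSFF (f : M → S3 × S3) (X Y : ∀ m : M, TangentSpace (𝓡 3) m) (m : M) : HH :=
  cov f X (lieField f Y) m - lieField f (indConn f X Y) m

lemma cov_lieField (f : M → S3 × S3) (X Y : ∀ m : M, TangentSpace (𝓡 3) m) (m : M) :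
    cov f X (lieField f Y) m = lieField f (indConn f X Y) m + lieSFF f X Y m :=
  (add_sub_cancel _ _).symm

lemma norPart_leftMul (m : M) (a : HH) : norPart f m (leftMul (emb f m) a) =
    leftMul (emb f m) (a - lieMap f m (tanPart f m (leftMul (emb f m) a))) := by
  rw [norPart, leftMul_sub, leftMul_lieMap]

/-- The cubic form `g(h(X, Y), J Z)`. -/
def cubicForm (f : M → S3 × S3) (X Y Z : ∀ m : M, TangentSpace (𝓡 3) m) (m : M) : ℝ :=
  lieMetric (lieSFF f X Y m) (lieJ (lieField f Z m))

namespace IsLagrangianImmersion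

lemma pullConn_leftMul (hf : IsLagrangianImmersion f) (hφ : φ m ∈ imPairs) :
    pullConn f m (X m) (fun x => leftMul (emb f x) (φ x)) = leftMul (emb f m) (cov f X φ m) := by
  have leftTriv_eq : (fun x => leftTriv (emb f x) (leftMul (emb f x) (φ x))) = φ :=
    funext fun x => leftTriv_leftMul (emb_mem f x) _
  rw [pullConn, leftTriv_eq, leftTriv_leftMul (emb_mem f m), cov, leftMul_add]
  exact congrArg _ (leviCivita_leftInv (emb_mem f m) (hf.lieMap_mem_imPairs m (X m)) hφ)

lemma pullConn_dmap (hf : IsLagrangianImmersion f) :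
    pullConn f m (X m) (fun x => dmap f x (Y x)) =
      leftMul (emb f m) (cov f X (lieField f Y) m) := by
  rw [← hf.pullConn_leftMul (hf.lieMap_mem_imPairs m (Y m))]
  simp only [leftMul_lieMap]

lemma indConn_eq (hf : IsLagrangianImmersion f) :
    indConn f X Y = fun m => tanPart f m (leftMul (emb f m) (cov f X (lieField f Y) m)) := by
  funext m
  rw [indConn, hf.pullConn_dmap]

lemma secondFF_eq (hf : IsLagrangianImmersion f) :
    secondFF f X Y = fun m => leftMul (emb f m) (lieSFF f X Y m) := by
  funext m
  rw [secondFF, hf.pullConn_dmap, norPart_leftMul, lieSFF, hf.indConn_eq]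

lemma lieMetric_lieMap_lieJ (hf : IsLagrangianImmersion f) (m : M) (v w : TangentSpace (𝓡 3) m) :
    lieMetric (lieMap f m v) (lieJ (lieMap f m w)) = 0 := by
  rw [lieMetric_comm, hf.lieMetric_lieJ_lieMap]

lemma lieMetric_cov_lieJ (hf : IsLagrangianImmersion f) :
    lieMetric (cov f X (lieField f Y) m) (lieJ (lieField f Z m)) = cubicForm f X Y Z m := by
  rw [cov_lieField, map_add, add_apply, hf.lieMetric_lieMap_lieJ, zero_add, cubicForm]

variable [IsManifold (𝓡 3) ∞ M]

lemma mdifferentiableAt_lieField (hf : IsLagrangianImmersion f) (hX : IsSmoothField X) :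
    MDifferentiableAt (𝓡 3) 𝓘(ℝ, HH) (lieField f X) m :=
  (hf.contMDiff_lieMap hX).mdifferentiable (by simp) m

lemma contMDiff_cov (hf : IsLagrangianImmersion f) (hX : IsSmoothField X)
    (hφ : ContMDiff (𝓡 3) 𝓘(ℝ, HH) ∞ φ) : ContMDiff (𝓡 3) 𝓘(ℝ, HH) ∞ (cov f X φ) :=
  (contMDiff_mvfderiv_apply hφ hX).add (contMDiff_bilin lieConn (hf.contMDiff_lieMap hX) hφ)

lemma lieSFF_mem_imPairs (hf : IsLagrangianImmersion f) (hY : IsSmoothField Y) (m : M) :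
    lieSFF f X Y m ∈ imPairs :=
  imPairs.sub_mem (cov_mem_imPairs (hf.mdifferentiableAt_lieField hY)
    fun x => hf.lieMap_mem_imPairs x (Y x)) (hf.lieMap_mem_imPairs m _)

lemma mvfderiv_dmap (hf : IsLagrangianImmersion f) (hY : IsSmoothField Y) :
    mvfderiv (𝓡 3) (fun x => dmap f x (Y x)) m (X m) = leftMul (emb f m)
      (lieField f X m * lieField f Y m + mvfderiv (𝓡 3) (lieField f Y) m (X m)) := by
  have hemb := hf.contMDiff_emb.mdifferentiable (by simp) m
  have dmap_eq : (fun x => dmap f x (Y x)) =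
      fun x => ContinuousLinearMap.mul ℝ HH (emb f x) (lieField f Y x) :=
    funext fun x => (leftMul_lieMap f x (Y x)).symm
  rw [dmap_eq, mvfderiv_bilin _ hemb (hf.mdifferentiableAt_lieField hY), leftMul_add]
  congr 1
  change dmap f m (X m) * _ = emb f m * (_ * _)
  rw [← mul_assoc, ← leftMul_lieMap]
  rfl

/-- The structure equation `dω(X, Y) = -[ω X, ω Y]` for the pull-back `ω` of the Maurer–Cartan
form. -/
lemma mvfderiv_lieField_sub (hf : IsLagrangianImmersion f) (hX : IsSmoothField X)
    (hY : IsSmoothField Y) (m : M) :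
    mvfderiv (𝓡 3) (lieField f Y) m (X m) - mvfderiv (𝓡 3) (lieField f X) m (Y m) =
      lieMap f m (VectorField.mlieBracket (𝓡 3) X Y m) -
        (lieField f X m * lieField f Y m - lieField f Y m * lieField f X m) := by
  have h : dmap f m (VectorField.mlieBracket (𝓡 3) X Y m) = _ :=
    mvfderiv_mlieBracket hX hY hf.contMDiff_emb m
  change _ = mvfderiv (𝓡 3) (fun x => dmap f x (Y x)) m (X m) -
    mvfderiv (𝓡 3) (fun x => dmap f x (X x)) m (Y m) at h
  rw [hf.mvfderiv_dmap hX, hf.mvfderiv_dmap hY, ← leftMul_lieMap, ← leftMul_sub] at h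
  have h' := congrArg (leftTriv (emb f m)) h
  rw [leftTriv_leftMul (emb_mem f m), leftTriv_leftMul (emb_mem f m)] at h'
  rw [h']
  abel

lemma cov_sub_cov (hf : IsLagrangianImmersion f) (hX : IsSmoothField X) (hY : IsSmoothField Y)
    (m : M) : cov f X (lieField f Y) m - cov f Y (lieField f X) m =
      lieMap f m (VectorField.mlieBracket (𝓡 3) X Y m) := by
  rw [cov, cov, add_sub_add_comm, hf.mvfderiv_lieField_sub hX hY, lieConn_apply, lieConn_apply,
    coeff_sub, sub_add_cancel]

lemma cov_cov (hf : IsLagrangianImmersion f) (hY : IsSmoothField Y)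
    (hφ : ContMDiff (𝓡 3) 𝓘(ℝ, HH) ∞ φ) : cov f X (cov f Y φ) m =
      mvfderiv (𝓡 3) (fun x => mvfderiv (𝓡 3) φ x (Y x)) m (X m) +
        (lieConn (mvfderiv (𝓡 3) (lieField f Y) m (X m)) (φ m) +
          lieConn (lieField f Y m) (mvfderiv (𝓡 3) φ m (X m))) +
        (lieConn (lieField f X m) (mvfderiv (𝓡 3) φ m (Y m)) +
          lieConn (lieField f X m) (lieConn (lieField f Y m) (φ m))) := by
  have hφY := (contMDiff_mvfderiv_apply hφ hY).mdifferentiable (by simp) m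
  have hconn := (contMDiff_bilin lieConn (hf.contMDiff_lieMap hY) hφ).mdifferentiable (by simp) m
  rw [← map_add, ← mvfderiv_bilin lieConn (hf.mdifferentiableAt_lieField hY)
    (hφ.mdifferentiable (by simp) m), ← add_apply, ← mvfderiv_fun_add hφY hconn]
  rfl

lemma cov_cov_sub_cov_cov (hf : IsLagrangianImmersion f) (hX : IsSmoothField X)
    (hY : IsSmoothField Y) (hφ : ContMDiff (𝓡 3) 𝓘(ℝ, HH) ∞ φ) (m : M) :
    cov f X (cov f Y φ) m - cov f Y (cov f X φ) m =
      lieCurv (lieField f X m) (lieField f Y m) (φ m) +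
        cov f (VectorField.mlieBracket (𝓡 3) X Y) φ m := by
  have structure_eq := congrArg (fun a => lieConn a (φ m)) (hf.mvfderiv_lieField_sub hX hY m)
  simp only [map_sub lieConn, sub_apply] at structure_eq
  rw [sub_eq_iff_eq_add] at structure_eq
  rw [hf.cov_cov hY hφ, hf.cov_cov hX hφ, lieCurv, cov, mvfderiv_mlieBracket hX hY hφ,
    structure_eq, map_sub, sub_apply]
  abel

lemma lieMetric_lieG_lieField (hf : IsLagrangianImmersion f) (hX : IsSmoothField X)
    (hY : IsSmoothField Y) (m : M) :
    lieMetric (lieG (lieField f Z m) (lieField f X m)) (lieField f Y m) =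
      cubicForm f Z X Y m - cubicForm f Z Y X m := by
  have hJX := (contMDiff_clm lieJ (hf.contMDiff_lieMap hX)).mdifferentiable (by simp) m
  have h := mvfderiv_lieMetric (f := f) (X := Z) hJX (hf.mdifferentiableAt_lieField hY)
  have lagrangian : (fun x => lieMetric (lieJ (lieField f X x)) (lieField f Y x)) = fun _ => 0 :=
    funext fun x => hf.lieMetric_lieJ_lieMap x _ _
  rw [lagrangian, mvfderiv_const, cov_lieJ (hf.mdifferentiableAt_lieField hX), map_add, add_apply,
    lieMetric_lieJ_left, hf.lieMetric_cov_lieJ, lieMetric_comm (lieJ _), hf.lieMetric_cov_lieJ,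
    zero_apply] at h
  linarith

variable [T2Space M]

lemma isSmoothField_indConn (hf : IsLagrangianImmersion f) (hX : IsSmoothField X)
    (hY : IsSmoothField Y) : IsSmoothField (indConn f X Y) := by
  rw [hf.indConn_eq]
  exact hf.isSmoothField_tanPart (hf.contMDiff_cov hX (hf.contMDiff_lieMap hY))

lemma contMDiff_lieSFF (hf : IsLagrangianImmersion f) (hX : IsSmoothField X)
    (hY : IsSmoothField Y) : ContMDiff (𝓡 3) 𝓘(ℝ, HH) ∞ (lieSFF f X Y) :=
  (hf.contMDiff_cov hX (hf.contMDiff_lieMap hY)).sub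
    (hf.contMDiff_lieMap (hf.isSmoothField_indConn hX hY))

lemma lieMetric_lieSFF_lieMap (hf : IsLagrangianImmersion f) (m : M) (w : TangentSpace (𝓡 3) m) :
    lieMetric (lieSFF f X Y m) (lieMap f m w) = 0 := by
  rw [lieSFF, hf.indConn_eq]
  exact hf.lieMetric_sub_tanPart m _ w

lemma lieMetric_lieSFF_lieJ_lieSFF (hf : IsLagrangianImmersion f) (hY : IsSmoothField Y) (m : M) :
    lieMetric (lieSFF f X Y m) (lieJ (lieSFF f Z W m)) = 0 := by
  obtain ⟨u, hu⟩ := hf.exists_eq_lieJ_lieMap (hf.lieSFF_mem_imPairs (X := X) hY m)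
    fun w => hf.lieMetric_lieSFF_lieMap m w
  rw [hu, lieMetric_lieJ_lieJ, lieMetric_comm, hf.lieMetric_lieSFF_lieMap]

lemma lieSFF_comm (hf : IsLagrangianImmersion f) (hX : IsSmoothField X) (hY : IsSmoothField Y) :
    lieSFF f X Y = lieSFF f Y X := funext fun m => by
  obtain ⟨u, hu⟩ : ∃ u, lieSFF f X Y m - lieSFF f Y X m = lieMap f m u := by
    refine ⟨VectorField.mlieBracket (𝓡 3) X Y m - indConn f X Y m + indConn f Y X m, ?_⟩
    rw [map_add, map_sub, ← hf.cov_sub_cov hX hY, lieSFF, lieSFF]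
    abel
  refine sub_eq_zero.1 (metric0_self_pos ?_)
  have normal : lieMetric (lieSFF f X Y m - lieSFF f Y X m) (lieMap f m u) = 0 := by
    rw [map_sub lieMetric, sub_apply, hf.lieMetric_lieSFF_lieMap, hf.lieMetric_lieSFF_lieMap,
      sub_zero]
  rwa [← hu] at normal

lemma cubicForm_swap_left (hf : IsLagrangianImmersion f) (hX : IsSmoothField X)
    (hY : IsSmoothField Y) (m : M) : cubicForm f X Y Z m = cubicForm f Y X Z m := by
  rw [cubicForm, cubicForm, hf.lieSFF_comm hX hY]

/-- `G` is totally skew, so its value on `X, Y, Z` is a third of the cyclic sum of the differences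
`g(h(Z, X), J Y) - g(h(Z, Y), J X)`, which cancel because `h` is symmetric. -/
lemma lieMetric_lieG_lieMap (hf : IsLagrangianImmersion f) (m : M) (u v w : TangentSpace (𝓡 3) m) :
    lieMetric (lieG (lieMap f m u) (lieMap f m v)) (lieMap f m w) = 0 := by
  obtain ⟨X, hX, rfl⟩ := exists_isSmoothField m u
  obtain ⟨Y, hY, rfl⟩ := exists_isSmoothField m v
  obtain ⟨Z, hZ, rfl⟩ := exists_isSmoothField m w
  have cyclic (a b c : HH) : lieMetric (lieG a b) c = lieMetric (lieG b c) a := by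
    rw [lieMetric_lieG_left, lieMetric_comm]
  have hXYZ := hf.lieMetric_lieG_lieField (Z := X) hY hZ m
  have hYZX := hf.lieMetric_lieG_lieField (Z := Y) hZ hX m
  have hZXY := hf.lieMetric_lieG_lieField (Z := Z) hX hY m
  rw [← cyclic, hf.cubicForm_swap_left hY hX] at hYZX
  rw [cyclic, hf.cubicForm_swap_left hZ hX, hf.cubicForm_swap_left hZ hY] at hZXY
  linarith

lemma cubicForm_swap_right (hf : IsLagrangianImmersion f) (hY : IsSmoothField Y)
    (hZ : IsSmoothField Z) (m : M) : cubicForm f X Y Z m = cubicForm f X Z Y m := by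
  have h := hf.lieMetric_lieG_lieField (Z := X) hY hZ m
  rwa [hf.lieMetric_lieG_lieMap, eq_comm, sub_eq_zero] at h

end IsLagrangianImmersion

end PullbackConnection

section QuarticForm

variable {M : Type*} [TopologicalSpace M] [ChartedSpace (EuclideanSpace ℝ (Fin 3)) M]
  {f : M → S3 × S3} {X Y Z W V : ∀ m : M, TangentSpace (𝓡 3) m} {m : M}

/-- The quartic form `g((∇h)(X, Y, Z), J W)`. -/
def quarticForm (f : M → S3 × S3) (X Y Z W : ∀ m : M, TangentSpace (𝓡 3) m) (m : M) : ℝ :=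
  nkMetric (emb f m) (nablaH f X Y Z m) (nkJ (emb f m) (dmap f m (W m)))

/-- The quartic form `g(h(Y, Z), G(W, V))`. -/
def sffG (f : M → S3 × S3) (Y Z W V : ∀ m : M, TangentSpace (𝓡 3) m) (m : M) : ℝ :=
  lieMetric (lieSFF f Y Z m) (lieG (lieField f W m) (lieField f V m))

lemma sffG_swap_right (f : M → S3 × S3) (Y Z W V : ∀ m : M, TangentSpace (𝓡 3) m) (m : M) :
    sffG f Y Z W V m = -sffG f Y Z V W m := by
  rw [sffG, lieG_swap, map_neg, sffG]

lemma cov_lieG {φ ψ : M → HH} (hφ : MDifferentiableAt (𝓡 3) 𝓘(ℝ, HH) φ m)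
    (hψ : MDifferentiableAt (𝓡 3) 𝓘(ℝ, HH) ψ m) (hX : lieField f X m ∈ imPairs)
    (hφm : φ m ∈ imPairs) (hψm : ψ m ∈ imPairs) :
    cov f X (fun x => lieG (φ x) (ψ x)) m =
      lieG (cov f X φ m) (ψ m) + lieG (φ m) (cov f X ψ m) +
        (1 / 3 : ℝ) • (lieMetric (lieField f X m) (ψ m) • lieJ (φ m)
          - lieMetric (lieField f X m) (φ m) • lieJ (ψ m)
          - lieMetric (lieJ (φ m)) (ψ m) • lieField f X m) := by
  rw [cov, mvfderiv_bilin lieG hφ hψ, ← lieConn_lieG hX hφm hψm]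
  simp only [cov, map_add, add_apply]
  abel

namespace IsLagrangianImmersion

lemma lieMetric_lieCurv (hf : IsLagrangianImmersion f) (m : M)
    (x y z w : TangentSpace (𝓡 3) m) :
    lieMetric (lieCurv (lieMap f m x) (lieMap f m y) (lieMap f m z)) (lieJ (lieMap f m w)) =
      1 / 3 * (formP (lieMap f m y) (lieMap f m z) * formPJ (lieMap f m x) (lieMap f m w)
        - formP (lieMap f m x) (lieMap f m z) * formPJ (lieMap f m y) (lieMap f m w)
        - formPJ (lieMap f m y) (lieMap f m z) * formP (lieMap f m x) (lieMap f m w)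
        + formPJ (lieMap f m x) (lieMap f m z) * formP (lieMap f m y) (lieMap f m w)) := by
  have formPJ_eq (a b : HH) : lieMetric (lieJ (lieP a)) b = -formPJ a b := by
    rw [formPJ, lieP_lieJ, map_neg, neg_apply, neg_neg]
  rw [lieCurv_eq (hf.lieMap_mem_imPairs m x) (hf.lieMap_mem_imPairs m y)
    (hf.lieMap_mem_imPairs m z)]
  simp only [map_add, map_sub, map_smul, add_apply, sub_apply, smul_apply, smul_eq_mul,
    lieMetric_lieJ_lieJ, lieMetric_lieP_lieJ, hf.lieMetric_lieJ_lieMap, hf.lieMetric_lieMap_lieJ]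
  simp only [formPJ_eq, formP]
  ring

variable [IsManifold (𝓡 3) ∞ M]

lemma quarticForm_eq (hf : IsLagrangianImmersion f) (hZ : IsSmoothField Z) (m : M) :
    quarticForm f X Y Z W m =
      lieMetric (cov f X (lieSFF f Y Z) m) (lieJ (lieField f W m))
        - cubicForm f (indConn f X Y) Z W m - cubicForm f Y (indConn f X Z) W m := by
  have hx := emb_mem f m
  rw [quarticForm, nablaH, norConn, hf.secondFF_eq, hf.secondFF_eq, hf.secondFF_eq,
    hf.pullConn_leftMul (hf.lieSFF_mem_imPairs hZ m), norPart_leftMul, ← leftMul_lieMap f m (W m),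
    nkJ_leftMul_eq hx, ← leftMul_sub, ← leftMul_sub, nkMetric_leftMul_eq hx]
  simp only [map_sub, sub_apply, hf.lieMetric_lieMap_lieJ, sub_zero, cubicForm]

variable [T2Space M]

lemma sffG_comm (hf : IsLagrangianImmersion f) (hY : IsSmoothField Y) (hZ : IsSmoothField Z)
    (m : M) : sffG f Y Z W V m = sffG f Z Y W V m := by
  rw [sffG, hf.lieSFF_comm hY hZ, sffG]

lemma quarticForm_eq_mvfderiv_cubicForm (hf : IsLagrangianImmersion f) (hY : IsSmoothField Y)
    (hZ : IsSmoothField Z) (hW : IsSmoothField W) (m : M) :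
    quarticForm f X Y Z W m =
      mvfderiv (𝓡 3) (cubicForm f Y Z W) m (X m) - cubicForm f (indConn f X Y) Z W m
        - cubicForm f Y (indConn f X Z) W m - cubicForm f Y Z (indConn f X W) m
        - sffG f Y Z X W m := by
  have hJW := (contMDiff_clm lieJ (hf.contMDiff_lieMap hW)).mdifferentiable (by simp) m
  have h : mvfderiv (𝓡 3) (cubicForm f Y Z W) m (X m) = _ := mvfderiv_lieMetric (f := f) (X := X)
    ((hf.contMDiff_lieSFF hY hZ).mdifferentiable (by simp) m) hJW
  rw [cov_lieJ (hf.mdifferentiableAt_lieField hW), cov_lieField, map_add, map_add, map_add,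
    hf.lieMetric_lieSFF_lieJ_lieSFF hZ, add_zero] at h
  rw [hf.quarticForm_eq hZ, h, sffG, cubicForm, cubicForm, cubicForm]
  ring

/-- `g(h(·, ·), J ·)` is symmetric, and `sffG` is the contribution of `∇̃J`. -/
lemma quarticForm_swap_right (hf : IsLagrangianImmersion f) (hX : IsSmoothField X)
    (hY : IsSmoothField Y) (hZ : IsSmoothField Z) (hW : IsSmoothField W) (m : M) :
    quarticForm f X Y Z W m + sffG f Y Z X W m =
      quarticForm f X Y W Z m + sffG f Y W X Z m := by
  rw [hf.quarticForm_eq_mvfderiv_cubicForm hY hZ hW, hf.quarticForm_eq_mvfderiv_cubicForm hY hW hZ,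
    funext (hf.cubicForm_swap_right (X := Y) hZ hW), hf.cubicForm_swap_right hZ hW,
    hf.cubicForm_swap_right (hf.isSmoothField_indConn hX hZ) hW,
    hf.cubicForm_swap_right hZ (hf.isSmoothField_indConn hX hW)]
  ring

lemma quarticForm_swap_middle (hf : IsLagrangianImmersion f) (hX : IsSmoothField X)
    (hY : IsSmoothField Y) (hZ : IsSmoothField Z) (m : M) :
    quarticForm f X Y Z W m = quarticForm f X Z Y W m := by
  rw [hf.quarticForm_eq hZ, hf.quarticForm_eq hY, hf.lieSFF_comm hY hZ,
    hf.cubicForm_swap_left (hf.isSmoothField_indConn hX hY) hZ,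
    hf.cubicForm_swap_left hY (hf.isSmoothField_indConn hX hZ)]
  ring

lemma mlieBracket_eq_indConn_sub (hf : IsLagrangianImmersion f) (hX : IsSmoothField X)
    (hY : IsSmoothField Y) :
    VectorField.mlieBracket (𝓡 3) X Y = indConn f X Y - indConn f Y X := funext fun m => by
  refine hf.lieMap_injective m ?_
  rw [← hf.cov_sub_cov hX hY, cov_lieField, cov_lieField, hf.lieSFF_comm hX hY, Pi.sub_apply,
    map_sub]
  abel

lemma lieMetric_cov_mlieBracket (hf : IsLagrangianImmersion f) (hX : IsSmoothField X)
    (hY : IsSmoothField Y) (m : M) :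
    lieMetric (cov f (VectorField.mlieBracket (𝓡 3) X Y) (lieField f Z) m)
      (lieJ (lieField f W m)) =
      cubicForm f (indConn f X Y) Z W m - cubicForm f (indConn f Y X) Z W m := by
  have cov_sub_left (U V : ∀ m : M, TangentSpace (𝓡 3) m) (φ : M → HH) :
      cov f (U - V) φ m = cov f U φ m - cov f V φ m := by
    simp only [cov, lieField, Pi.sub_apply, map_sub, sub_apply]
    abel
  rw [hf.mlieBracket_eq_indConn_sub hX hY, cov_sub_left, map_sub, sub_apply, hf.lieMetric_cov_lieJ,
    hf.lieMetric_cov_lieJ]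

lemma quarticForm_eq_cov_cov (hf : IsLagrangianImmersion f) (hY : IsSmoothField Y)
    (hZ : IsSmoothField Z) (m : M) :
    quarticForm f X Y Z W m =
      lieMetric (cov f X (cov f Y (lieField f Z)) m) (lieJ (lieField f W m))
        - cubicForm f X (indConn f Y Z) W m - cubicForm f (indConn f X Y) Z W m
        - cubicForm f Y (indConn f X Z) W m := by
  have h : cov f X (lieSFF f Y Z) m = _ := cov_sub
    ((hf.contMDiff_cov hY (hf.contMDiff_lieMap hZ)).mdifferentiable (by simp) m)
    (hf.mdifferentiableAt_lieField (hf.isSmoothField_indConn hY hZ))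
  rw [hf.quarticForm_eq hZ, h, map_sub, sub_apply, hf.lieMetric_cov_lieJ]

lemma codazzi (hf : IsLagrangianImmersion f) (hX : IsSmoothField X) (hY : IsSmoothField Y)
    (hZ : IsSmoothField Z) (m : M) :
    quarticForm f X Y Z W m - quarticForm f Y X Z W m =
      lieMetric (lieCurv (lieField f X m) (lieField f Y m) (lieField f Z m))
        (lieJ (lieField f W m)) := by
  have ricci := congrArg (fun a => lieMetric a (lieJ (lieField f W m)))
    (hf.cov_cov_sub_cov_cov hX hY (hf.contMDiff_lieMap hZ) m)
  simp only [map_sub lieMetric, map_add lieMetric, sub_apply, add_apply,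
    hf.lieMetric_cov_mlieBracket hX hY] at ricci
  rw [hf.quarticForm_eq_cov_cov hY hZ, hf.quarticForm_eq_cov_cov hX hZ]
  linarith

/-- Differentiate `g(G(Y, Z), V) = 0` along `W`. -/
lemma sffG_cyclic (hf : IsLagrangianImmersion f) (hY : IsSmoothField Y) (hZ : IsSmoothField Z)
    (hV : IsSmoothField V) (m : M) :
    sffG f W Y Z V m + sffG f W Z V Y m + sffG f W V Y Z m = 0 := by
  have hGYZ := (contMDiff_bilin lieG (hf.contMDiff_lieMap hY)
    (hf.contMDiff_lieMap hZ)).mdifferentiable (by simp) m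
  have h := mvfderiv_lieMetric (f := f) (X := W) hGYZ (hf.mdifferentiableAt_lieField hV)
  rw [funext fun x => hf.lieMetric_lieG_lieMap x (Y x) (Z x) (V x), mvfderiv_const,
    cov_lieG (hf.mdifferentiableAt_lieField hY) (hf.mdifferentiableAt_lieField hZ)
      (hf.lieMap_mem_imPairs m _) (hf.lieMap_mem_imPairs m _) (hf.lieMap_mem_imPairs m _)] at h
  simp only [cov_lieField, map_add, map_sub, map_smul, add_apply, sub_apply, smul_apply,
    zero_apply, smul_eq_mul, hf.lieMetric_lieG_lieMap, hf.lieMetric_lieJ_lieMap] at h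
  have hY' : lieMetric (lieG (lieSFF f W Y m) (lieField f Z m)) (lieField f V m) =
    sffG f W Y Z V m := lieMetric_lieG_left _ _ _
  have hZ' : lieMetric (lieG (lieField f Y m) (lieSFF f W Z m)) (lieField f V m) =
      sffG f W Z V Y m := by
    rw [lieMetric_lieG_right, sffG_swap_right, sffG]
  have hV' : lieMetric (lieG (lieField f Y m) (lieField f Z m)) (lieSFF f W V m) =
    sffG f W V Y Z m := lieMetric_comm _ _
  linarith

end IsLagrangianImmersion

end QuarticForm

section Polarization

variable {A R : Type*} [Add A] [AddCommGroup R]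

/-- Symmetric biadditive maps. -/
structure IsSymmBiadditive (B : A → A → R) : Prop where
  swap : ∀ a b, B a b = B b a
  add_right : ∀ a b b', B a (b + b') = B a b + B a b'

/-- Symmetric triadditive maps, by induction on the number of arguments. -/
structure IsSymmTriadditive (T : A → A → A → R) : Prop where
  swap : ∀ a b c, T a b c = T b a c
  right : ∀ a, IsSymmBiadditive (T a)

/-- Symmetric quadriadditive maps, by induction on the number of arguments. -/
structure IsSymmQuadriadditive (Q : A → A → A → A → R) : Prop where
  swap : ∀ a b c d, Q a b c d = Q b a c d
  right : ∀ a, IsSymmTriadditive (Q a)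

lemma IsSymmBiadditive.add_left {B : A → A → R} (hB : IsSymmBiadditive B) (a a' b : A) :
    B (a + a') b = B a b + B a' b := by
  rw [hB.swap, hB.add_right, hB.swap b, hB.swap b]

lemma IsSymmTriadditive.add_left {T : A → A → A → R} (hT : IsSymmTriadditive T) (a a' b c : A) :
    T (a + a') b c = T a b c + T a' b c := by
  rw [hT.swap, (hT.right b).add_left, hT.swap b, hT.swap b]

lemma IsSymmQuadriadditive.add_left {Q : A → A → A → A → R} (hQ : IsSymmQuadriadditive Q)
    (a a' b c d : A) : Q (a + a') b c d = Q a b c d + Q a' b c d := by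
  rw [hQ.swap, (hQ.right b).add_left, hQ.swap b, hQ.swap b]

lemma IsSymmBiadditive.diag_add {B : A → A → R} (hB : IsSymmBiadditive B) (a b : A) :
    B (a + b) (a + b) = B a a + 2 • B a b + B b b := by
  rw [hB.add_left, hB.add_right, hB.add_right, hB.swap b a]
  abel

lemma IsSymmTriadditive.diag_add {T : A → A → A → R} (hT : IsSymmTriadditive T) (a b : A) :
    T (a + b) (a + b) (a + b) = T a a a + 3 • T a a b + 3 • T a b b + T b b b := by
  rw [hT.add_left, (hT.right a).diag_add, (hT.right b).diag_add, hT.swap b a, hT.swap b a,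
    (hT.right a).swap b a]
  abel

lemma IsSymmQuadriadditive.diag_add {Q : A → A → A → A → R} (hQ : IsSymmQuadriadditive Q)
    (a b : A) : Q (a + b) (a + b) (a + b) (a + b) =
      Q a a a a + 4 • Q a a a b + 6 • Q a a b b + 4 • Q a b b b + Q b b b b := by
  rw [hQ.add_left, (hQ.right a).diag_add, (hQ.right b).diag_add, hQ.swap b a, hQ.swap b a,
    hQ.swap b a, (hQ.right a).swap b a, ((hQ.right a).right a).swap b a, (hQ.right a).swap b a]
  abel

variable [Module ℚ R]

lemma IsSymmBiadditive.eq_zero {B : A → A → R} (hB : IsSymmBiadditive B) (h : ∀ a, B a a = 0)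
    (a b : A) : B a b = 0 := by
  have hab := hB.diag_add a b
  simp only [h] at hab
  linear_combination (norm := module) (-1 / 2 : ℚ) • hab

lemma IsSymmTriadditive.eq_zero {T : A → A → A → R} (hT : IsSymmTriadditive T)
    (h : ∀ a, T a a a = 0) (a b c : A) : T a b c = 0 := by
  refine (hT.right a).eq_zero (fun b => ?_) b c
  have hab := hT.diag_add a b
  have haab := hT.diag_add (a + a) b
  simp only [h, hT.add_left, (hT.right a).add_left] at hab haab
  linear_combination (norm := module) (1 / 6 : ℚ) • haab - (2 / 3 : ℚ) • hab

lemma IsSymmQuadriadditive.eq_zero {Q : A → A → A → A → R} (hQ : IsSymmQuadriadditive Q)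
    (h : ∀ a, Q a a a a = 0) (a b c d : A) : Q a b c d = 0 := by
  refine (hQ.right a).eq_zero (fun b => ?_) b c d
  have hab := hQ.diag_add a b
  have haab := hQ.diag_add (a + a) b
  have habb := hQ.diag_add a (b + b)
  simp only [h, hQ.add_left, (hQ.right a).add_left, ((hQ.right _).right _).add_left,
    ((hQ.right _).right _).add_right] at hab haab habb
  linear_combination (norm := module) (1 / 2 : ℚ) • hab - (1 / 24 : ℚ) • haab
    - (1 / 12 : ℚ) • habb

end Polarization

section PairSum

variable {A : Type*} {α β γ : A → A → ℝ}

/-- The sum of `α ⊗ β` over the three pairings of four arguments, the first of which goes to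
`α`. -/
def pairSum (α β : A → A → ℝ) (a b c d : A) : ℝ :=
  cyclicSum (fun b c d => α a b * β c d) b c d

lemma pairSum_swap_middle (hβ : ∀ a b, β a b = β b a) (a b c d : A) :
    pairSum α β a b c d = pairSum α β a c b d := by
  simp only [pairSum, cyclicSum, hβ d, hβ c b]
  ring

lemma pairSum_swap_right (hβ : ∀ a b, β a b = β b a) (a b c d : A) :
    pairSum α β a b c d = pairSum α β a b d c := by
  simp only [pairSum, cyclicSum, hβ d, hβ c b]
  ring

lemma pairSum_self_swap_left (hγ : ∀ a b, γ a b = γ b a) (a b c d : A) :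
    pairSum γ γ a b c d = pairSum γ γ b a c d := by
  simp only [pairSum, cyclicSum, hγ d, hγ b a]
  ring

lemma pairSum_sub_pairSum_swap_left (hα : ∀ a b, α a b = α b a) (hβ : ∀ a b, β a b = β b a)
    (a b c d : A) :
    (pairSum α β a b c d - pairSum β α a b c d) - (pairSum α β b a c d - pairSum β α b a c d) =
      2 * (α a c * β b d - α b c * β a d + α a d * β b c - α b d * β a c) := by
  simp only [pairSum, cyclicSum, hα d, hβ d, hα b a, hβ b a]
  ring

end PairSum

section PolarizedForm

variable {M : Type*} [TopologicalSpace M] [ChartedSpace (EuclideanSpace ℝ (Fin 3)) M]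
  {f : M → S3 × S3} {Y Z W V : ∀ m : M, TangentSpace (𝓡 3) m} {m : M}

/-- The left-hand side of the polarized identity at `m`, for `λ(m) = r`. -/
def polarizedForm (f : M → S3 × S3) (r : ℝ) (m : M) (Y Z W V : ∀ m : M, TangentSpace (𝓡 3) m) :
    ℝ :=
  let y := lieField f Y m
  let z := lieField f Z m
  let w := lieField f W m
  let v := lieField f V m
  12 * quarticForm f Y Z W V m + 3 * cyclicSum (fun Y Z W => sffG f Y Z W V m) Y Z W
    + 2 * (pairSum formP formPJ y z w v - pairSum formPJ formP y z w v)
    - 4 * r * pairSum (fun a b => lieMetric a b) (fun a b => lieMetric a b) y z w v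

lemma polarizedForm_diag (f : M → S3 × S3) (r : ℝ) (m : M) (X : ∀ m : M, TangentSpace (𝓡 3) m) :
    polarizedForm f r m X X X X =
      12 * (quarticForm f X X X X m
        - r * (nkMetric (emb f m) (dmap f m (X m)) (dmap f m (X m))) ^ 2) := by
  have sffG_self : sffG f X X X X m = 0 := by linarith [sffG_swap_right f X X X X m]
  rw [← leftMul_lieMap, nkMetric_leftMul_eq (emb_mem f m)]
  simp only [polarizedForm, pairSum, cyclicSum, sffG_self]
  ring

variable (M) in
/-- The smooth vector fields on `M`, the arguments of the polarized form. Closure under addition is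
all that polarization uses. -/
def smoothFields [IsManifold (𝓡 3) ∞ M] : AddSubsemigroup (∀ m : M, TangentSpace (𝓡 3) m) where
  carrier := {X | IsSmoothField X}
  add_mem' hX hY := ContMDiff.add_section hX hY

namespace IsLagrangianImmersion

variable [IsManifold (𝓡 3) ∞ M]

lemma polarizedIdentity_iff (hf : IsLagrangianImmersion f) (lam : M → ℝ) :
    PolarizedIdentity f lam ↔ ∀ Y Z W V : (∀ m : M, TangentSpace (𝓡 3) m),
      IsSmoothField Y → IsSmoothField Z → IsSmoothField W → IsSmoothField V → ∀ m : M,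
      polarizedForm f (lam m) m Y Z W V = 0 := by
  refine forall₄_congr fun Y Z W V => forall₅_congr fun _ _ _ _ m => Eq.congr_left ?_
  have hx := emb_mem f m
  simp only [polarizedForm, pairSum, cyclicSum, quarticForm, sffG, hf.secondFF_eq, ← leftMul_lieMap,
    nkJ_leftMul_eq hx, nkP_leftMul hx, nkMetric_leftMul_eq hx,
    nkG_leftMul hx (hf.lieMap_mem_imPairs m _) (hf.lieMap_mem_imPairs m _)]
  simp only [formP, formPJ]
  ring

lemma polarizedForm_add_right (hf : IsLagrangianImmersion f) (r : ℝ) (m : M)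
    (hW : IsSmoothField W) (V V' : ∀ m : M, TangentSpace (𝓡 3) m) :
    polarizedForm f r m Y Z W (V + V') =
      polarizedForm f r m Y Z W V + polarizedForm f r m Y Z W V' := by
  simp only [polarizedForm, pairSum, cyclicSum, hf.quarticForm_eq hW, cubicForm, sffG, formP,
    formPJ, lieField, Pi.add_apply, map_add, add_apply]
  ring

variable [T2Space M]

lemma cyclicSum_sffG_swap_left (hf : IsLagrangianImmersion f) (hY : IsSmoothField Y)
    (hZ : IsSmoothField Z) (hW : IsSmoothField W) (m : M) :
    cyclicSum (fun Y Z W => sffG f Y Z W V m) Y Z W =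
      cyclicSum (fun Y Z W => sffG f Y Z W V m) Z Y W := by
  rw [cyclicSum, cyclicSum, hf.sffG_comm hY hZ, hf.sffG_comm hZ hW, hf.sffG_comm hW hY]
  ring

lemma cyclicSum_sffG_swap_middle (hf : IsLagrangianImmersion f) (hY : IsSmoothField Y)
    (hZ : IsSmoothField Z) (hW : IsSmoothField W) (m : M) :
    cyclicSum (fun Y Z W => sffG f Y Z W V m) Y Z W =
      cyclicSum (fun Y Z W => sffG f Y Z W V m) Y W Z := by
  rw [cyclicSum, cyclicSum, hf.sffG_comm hY hZ, hf.sffG_comm hZ hW, hf.sffG_comm hW hY]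
  ring

lemma cyclicSum_sffG_sub_swap_right (hf : IsLagrangianImmersion f) (hY : IsSmoothField Y)
    (hZ : IsSmoothField Z) (hW : IsSmoothField W) (hV : IsSmoothField V) (m : M) :
    cyclicSum (fun Y Z W => sffG f Y Z W V m) Y Z W
        - cyclicSum (fun Y Z V => sffG f Y Z V W m) Y Z V =
      4 * (sffG f Z W Y V m - sffG f Z V Y W m) := by
  have cyclic_Z := hf.sffG_cyclic (W := Z) hY hW hV m
  have cyclic_Y := hf.sffG_cyclic (W := Y) hZ hW hV m
  rw [cyclicSum, cyclicSum, hf.sffG_comm hW hY, hf.sffG_comm hV hY]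
  rw [hf.sffG_comm hZ hY, sffG_swap_right f Z W V] at cyclic_Z
  rw [sffG_swap_right f Y W V] at cyclic_Y
  rw [sffG_swap_right f Y Z V W]
  linarith

lemma polarizedForm_swap_left (hf : IsLagrangianImmersion f) (r : ℝ) (m : M)
    (hY : IsSmoothField Y) (hZ : IsSmoothField Z) (hW : IsSmoothField W) :
    polarizedForm f r m Y Z W V = polarizedForm f r m Z Y W V := by
  have codazzi := hf.codazzi (W := V) hY hZ hW m
  have pairs := pairSum_sub_pairSum_swap_left formP_comm formPJ_comm (lieField f Y m)
    (lieField f Z m) (lieField f W m) (lieField f V m)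
  rw [hf.lieMetric_lieCurv] at codazzi
  simp only [polarizedForm]
  rw [hf.cyclicSum_sffG_swap_left hY hZ hW, pairSum_self_swap_left lieMetric_comm]
  linear_combination 12 * codazzi + 2 * pairs

lemma polarizedForm_swap_middle (hf : IsLagrangianImmersion f) (r : ℝ) (m : M)
    (hY : IsSmoothField Y) (hZ : IsSmoothField Z) (hW : IsSmoothField W) :
    polarizedForm f r m Y Z W V = polarizedForm f r m Y W Z V := by
  simp only [polarizedForm]
  rw [hf.quarticForm_swap_middle hY hZ hW, hf.cyclicSum_sffG_swap_middle hY hZ hW,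
    pairSum_swap_middle formPJ_comm, pairSum_swap_middle formP_comm,
    pairSum_swap_middle lieMetric_comm]

lemma polarizedForm_swap_right (hf : IsLagrangianImmersion f) (r : ℝ) (m : M)
    (hY : IsSmoothField Y) (hZ : IsSmoothField Z) (hW : IsSmoothField W) (hV : IsSmoothField V) :
    polarizedForm f r m Y Z W V = polarizedForm f r m Y Z V W := by
  have quartic := hf.quarticForm_swap_right hY hZ hW hV m
  have cyclic := hf.cyclicSum_sffG_sub_swap_right hY hZ hW hV m
  simp only [polarizedForm]
  rw [pairSum_swap_right formPJ_comm, pairSum_swap_right formP_comm,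
    pairSum_swap_right lieMetric_comm]
  linear_combination 12 * quartic + 3 * cyclic

lemma isSymmQuadriadditive_polarizedForm (hf : IsLagrangianImmersion f) (r : ℝ) (m : M) :
    IsSymmQuadriadditive fun Y Z W V : smoothFields M => polarizedForm f r m Y Z W V where
  swap Y Z W _ := hf.polarizedForm_swap_left r m Y.2 Z.2 W.2
  right Y :=
    { swap := fun Z W _ => hf.polarizedForm_swap_middle r m Y.2 Z.2 W.2
      right := fun Z =>
        { swap := fun W V => hf.polarizedForm_swap_right r m Y.2 Z.2 W.2 V.2
          add_right := fun W V V' => hf.polarizedForm_add_right r m W.2 V V' } }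

lemma isJIsotropicWith_iff (hf : IsLagrangianImmersion f) (lam : M → ℝ) :
    IsJIsotropicWith f lam ↔ PolarizedIdentity f lam := by
  rw [hf.polarizedIdentity_iff]
  constructor
  · intro h Y Z W V hY hZ hW hV m
    have diag (X : smoothFields M) : polarizedForm f (lam m) m X X X X = 0 := by
      rw [polarizedForm_diag, quarticForm, h m _ X X.2 rfl, sub_self, mul_zero]
    exact (hf.isSymmQuadriadditive_polarizedForm (lam m) m).eq_zero diag
      ⟨Y, hY⟩ ⟨Z, hZ⟩ ⟨W, hW⟩ ⟨V, hV⟩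
  · rintro h m v X hX rfl
    have diag := h X X X X hX hX hX hX m
    rw [polarizedForm_diag, quarticForm] at diag
    linarith

end IsLagrangianImmersion

end PolarizedForm

end NKS3S3

end

theorem proposition4p1 {M : Type*} [TopologicalSpace M] [T2Space M]
    [ChartedSpace (EuclideanSpace ℝ (Fin 3)) M] [IsManifold (𝓡 3) ∞ M]
    (f : M → NKS3S3.S3 × NKS3S3.S3) (hf : NKS3S3.IsLagrangianImmersion f) :
    (NKS3S3.IsJIsotropic f ↔ ∃ lam : M → ℝ, NKS3S3.PolarizedIdentity f lam) ∧
      ∀ lam : M → ℝ, NKS3S3.IsJIsotropicWith f lam ↔ NKS3S3.PolarizedIdentity f lam :=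
  ⟨exists_congr hf.isJIsotropicWith_iff, hf.isJIsotropicWith_iff⟩
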